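/- Let $a\in\{1,3\}$, let $h,k$ be integers with $0\le h<k$ and $\gcd(h,k)=1$, let $z\in\mathbb{C}$ with $\Re(z)>0$, and put $\tau=\frac hk+\frac{iz}{k}$, $q=e^{2\pi i\tau}$. Write $(x;q)_\infty=\prod_{j\ge0}(1-xq^j)$, and for $a\in\{1,3,5,7\}$ $$F_a(q)=\frac{1}{(q^a;q^8)_\infty(q^4;q^8)_\infty(q^{8-a};q^8)_\infty}$$ (so $F_5=F_3$, $F_7=F_1$). Let $f(u,w)=(-u;uw)_\infty(-w;uw)_\infty(uw;uw)_\infty$ be Ramanujan's theta function. For integers $\alpha,\beta,\gamma,\delta$ with $\alpha\delta-\beta\gamma=1$, $\gamma>0$, let $$\epsilon(\alpha,\beta,\gamma,\delta)=\begin{cases}\left(\frac{\delta}{\gamma}\right)i^{(1-\gamma)/2}\exp\left(\frac{\pi i}{12}\left(\beta\delta(1-\gamma^2)+\gamma(\alpha+\delta)\right)\right), & 2\nmid\gamma,\\[4pt] \left(\frac{\gamma}{|\delta|}\right)\exp\left(\frac{\pi i\delta}{4}+\frac{\pi i}{12}\left(\alpha\gamma(1-\delta^2)+\delta(\beta-\gamma)\right)\right),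 & 2\mid\gamma,\end{cases}$$ with Jacobi symbols. Let $d=\gcd(k,8)$, let $H=H_d$ be any integer with $hH\equiv-1\pmod{16k}$ if $d=8$, and with $\frac{8h}{d}H\equiv-1\pmod{k/d}$ if $d\in\{1,2,4\}$, and put $$\tau'=\frac{H}{k}+\frac{d\,i z^{-1}}{8k},\qquad y=e^{2\pi i\tau'}.$$ If $d=8$ let $\epsilon(8,8)=\epsilon\left(h,-\frac8k(hH+1),\frac k8,-H\right)$ and $\epsilon(8,4)=\epsilon\left(h,-\frac4k(hH+1),\frac k4,-H\right)$. If $d\in\{1,2,4\}$ let $\epsilon(d,8)=\epsilon\left(\frac{8h}d,-\frac dk\left(\frac{8hH}d+1\right),\frac kd,-H\right)$, $\epsilon(d,4)=\epsilon\left(\frac{4h}d,-\frac dk\left(\frac{8hH}d+1\right),\frac kd,-2H\right)$, and $\rho_{a,d}=\exp\left(\frac{\pi i a d}{4k}\left(\frac{8hH}{d}+1\right)\right)$. Then the following hold, and in each case $\omega_{a,d}(h,k)$ is a root of unity. 1. If $d=8$, then with $b$ the least positive residue of $ah$ modulo $8$, $$F_a(q)=\omega_{a,8}(h,k)\exp\left(\frac{\pi}{8k}\left(\frac{(b-4)^2-8}{z}+z(4a-5)\right)\right)F_b(y),$$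 $$\omega_{a,8}(h,k)=\frac{i(-1)^{\lfloor ah/8\rfloor}}{\epsilon(8,8)\epsilon(8,4)}\exp\left(\frac{\pi i}{8k}\left(h(5-4a)-H\left((b-4)^2-8\right)\right)\right).$$ 2. If $d=4$, then with $b$ the least positive residue of $ah$ modulo $4$, $$F_a(q)=\frac1{\sqrt2}\,\omega_{a,4}(h,k)\exp\left(\frac{\pi}{8k}\left(\frac1z+z(4a-5)\right)\right)\Psi_{a,4}(y),\qquad \Psi_{a,4}(y)=\frac{(y^4;y^4)_\infty^2}{(y^8;y^8)_\infty\, f(-\rho_{a,4}^{-1}y^b,-\rho_{a,4}y^{4-b})},$$ $$\omega_{a,4}(h,k)=\frac{i(-1)^{\lfloor ah/4\rfloor}}{\epsilon(4,8)\epsilon(4,4)}\exp\left(\frac{\pi i}{4k}\left(h-H-h(4a-3)(hH+1)+a(2hH+1)(b-2)\right)\right).$$ 3. If $d=2$, $$F_a(q)=\frac1{\sqrt2}\,\omega_{a,2}(h,k)\exp\left(\frac{\pi}{8k}\,z(4a-5)\right)\Psi_{a,2}(y),\qquad \Psi_{a,2}(y)=\frac{(y^2;y^2)_\infty^2}{(y^4;y^4)_\infty\,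 f(-\rho_{a,2}y,-\rho_{a,2}^{-1}y)},$$ $$\omega_{a,2}(h,k)=\frac{i(-1)^{\lfloor ah/2\rfloor}}{\epsilon(2,8)\epsilon(2,4)}\exp\left(\frac{\pi i}{4k}\,h\left(1-(4a-3)(2hH+1)\right)\right).$$ 4. If $d=1$, $$F_a(q)=\frac1{2\sqrt2}\,\omega_{a,1}(h,k)\left|\csc\left(\frac{\pi ak}{8}\right)\right|\exp\left(\frac{\pi}{8k}\left(\frac1{4z}+z(4a-5)\right)\right)\Psi_{a,1}(y),\qquad \Psi_{a,1}(y)=\frac{(y;y)_\infty}{(y^2;y^2)_\infty(\rho_{a,1}y;y)_\infty(\rho_{a,1}^{-1}y;y)_\infty},$$ $$\omega_{a,1}(h,k)=\frac{(-1)^{\lfloor -a(8hH+1)/(8k)\rfloor+h-1}}{\epsilon(1,8)\epsilon(1,4)}\exp\left(\frac{\pi i}{4k}\left(4h(1-a+hH(3-4a))-H\right)\right).$$ -/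

import Mathlib

open Complex

noncomputable section

namespace GollnitzGordon

/-- The `q`-Pochhammer symbol `(x; q)_∞ = ∏_{j ≥ 0} (1 - x q^j)` (used for `|q| < 1`). -/
def qPoch (x q : ℂ) : ℂ := ∏' j : ℕ, (1 - x * q ^ j)

/-- The generating function
`F_a(q) = 1 / ((q^a; q^8)_∞ (q^4; q^8)_∞ (q^{8-a}; q^8)_∞)` (used for `a = 1, 3, 5, 7`). -/
def F (a : ℕ) (q : ℂ) : ℂ :=
  1 / (qPoch (q ^ a) (q ^ 8) * qPoch (q ^ 4) (q ^ 8) * qPoch (q ^ (8 - a)) (q ^ 8))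

/-- Ramanujan's theta function in product form,
`f(u, w) = (-u; uw)_∞ (-w; uw)_∞ (uw; uw)_∞` (used for `|uw| < 1`). -/
def ramanujanTheta (u w : ℂ) : ℂ :=
  qPoch (-u) (u * w) * qPoch (-w) (u * w) * qPoch (u * w) (u * w)

/-- The root of unity `ε(a, b, c, d)` in the transformation law of the Dedekind eta function under
the matrix `(a, b; c, d) ∈ SL(2, ℤ)` with `c > 0`. The two expressions agree when `c` and `d` are
both odd. The Jacobi symbol `(c / d)` with `c > 0` and `d` odd is read as `(c / |d|)`. -/
def etaMult (a b c d : ℤ) : ℂ :=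
  if Odd c then
    (jacobiSym d c.natAbs : ℂ) * I ^ ((1 - c) / 2)
      * exp (Real.pi * I / 12 * (b * d * (1 - c ^ 2) + c * (a + d)))
  else
    (jacobiSym c d.natAbs : ℂ)
      * exp (Real.pi * I * d / 4 + Real.pi * I / 12 * (a * c * (1 - d ^ 2) + d * (b - c)))

/-- `ε(8,8) = ε(h, -(8/k)(hH + 1), k/8, -H)`; all the divisions are exact. -/
def eps88 (h k : ℕ) (H : ℤ) : ℂ :=
  etaMult h (-(8 * (h * H + 1) / k)) (k / 8) (-H)

/-- `ε(8,4) = ε(h, -(4/k)(hH + 1), k/4, -H)`; all the divisions are exact. -/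
def eps84 (h k : ℕ) (H : ℤ) : ℂ :=
  etaMult h (-(4 * (h * H + 1) / k)) (k / 4) (-H)

/-- `ε(d,8) = ε(8h/d, -(d/k)(8hH/d + 1), k/d, -H)`, for `d = 1, 2, 4`;
all the divisions are exact. -/
def epsD8 (d h k : ℕ) (H : ℤ) : ℂ :=
  etaMult (8 * h / d) (-(d * (8 * h / d * H + 1) / k)) (k / d) (-H)

/-- `ε(d,4) = ε(4h/d, -(d/k)(8hH/d + 1), k/d, -2H)`, for `d = 1, 2, 4`;
all the divisions are exact. -/
def epsD4 (d h k : ℕ) (H : ℤ) : ℂ :=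
  etaMult (4 * h / d) (-(d * (8 * h / d * H + 1) / k)) (k / d) (-2 * H)

/-- `ρ_{a,d} = exp((π i a d / 4k) (8hH/d + 1))`. -/
def rho (a d h k : ℕ) (H : ℤ) : ℂ :=
  exp (Real.pi * I * a * d / (4 * k) * (8 * h * H / d + 1))

/-- `ω_{a,8}(h,k)`, where `b` is the least positive residue of `ah` modulo `8`. -/
def omega8 (a h k : ℕ) (H : ℤ) : ℂ :=
  let b : ℕ := a * h % 8
  I * (-1) ^ ⌊(a * h : ℚ) / 8⌋ / (eps88 h k H * eps84 h k H)
    * exp (Real.pi * I / (8 * k) * (h * (5 - 4 * a) - H * (((b : ℂ) - 4) ^ 2 - 8)))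

/-- `ω_{a,4}(h,k)`, where `b` is the least positive residue of `ah` modulo `4`. -/
def omega4 (a h k : ℕ) (H : ℤ) : ℂ :=
  let b : ℕ := a * h % 4
  I * (-1) ^ ⌊(a * h : ℚ) / 4⌋ / (epsD8 4 h k H * epsD4 4 h k H)
    * exp (Real.pi * I / (4 * k)
        * (h - H - h * (4 * a - 3) * (h * H + 1) + a * (2 * h * H + 1) * ((b : ℂ) - 2)))

/-- `ω_{a,2}(h,k)`. -/
def omega2 (a h k : ℕ) (H : ℤ) : ℂ :=
  I * (-1) ^ ⌊(a * h : ℚ) / 2⌋ / (epsD8 2 h k H * epsD4 2 h k H)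
    * exp (Real.pi * I / (4 * k) * (h * (1 - (4 * a - 3) * (2 * h * H + 1))))

/-- `ω_{a,1}(h,k)`. -/
def omega1 (a h k : ℕ) (H : ℤ) : ℂ :=
  (-1) ^ (⌊-(a * (8 * h * H + 1) : ℚ) / (8 * k)⌋ + h - 1) / (epsD8 1 h k H * epsD4 1 h k H)
    * exp (Real.pi * I / (4 * k) * (4 * h * (1 - a + h * H * (3 - 4 * a)) - H))

/-- `Ψ_{a,4}(y)`, with `b` the least positive residue of `ah` modulo `4` and `ρ = ρ_{a,4}`. -/
def Psi4 (b : ℕ) (ρ y : ℂ) : ℂ :=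
  qPoch (y ^ 4) (y ^ 4) ^ 2
    / (qPoch (y ^ 8) (y ^ 8) * ramanujanTheta (-(ρ⁻¹ * y ^ b)) (-(ρ * y ^ (4 - b))))

/-- `Ψ_{a,2}(y)`, with `ρ = ρ_{a,2}`. -/
def Psi2 (ρ y : ℂ) : ℂ :=
  qPoch (y ^ 2) (y ^ 2) ^ 2
    / (qPoch (y ^ 4) (y ^ 4) * ramanujanTheta (-(ρ * y)) (-(ρ⁻¹ * y)))

/-- `Ψ_{a,1}(y)`, with `ρ = ρ_{a,1}`. -/
def Psi1 (ρ y : ℂ) : ℂ :=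
  qPoch y y / (qPoch (y ^ 2) (y ^ 2) * qPoch (ρ * y) y * qPoch (ρ⁻¹ * y) y)

/-- `q = e^{2πiτ}` with `τ = h/k + iz/k`. -/
def qAt (h k : ℕ) (z : ℂ) : ℂ := exp (2 * Real.pi * I * (h / k + I * z / k))

/-- `y = e^{2πiτ'}` with `τ' = H/k + d i z⁻¹ / (8k)`. -/
def yAt (d k : ℕ) (H : ℤ) (z : ℂ) : ℂ :=
  exp (2 * Real.pi * I * (H / k + d * I * z⁻¹ / (8 * k)))

end GollnitzGordon

end

noncomputable section

namespace GollnitzGordon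

open Filter Topology

/-! ### The Jacobi triple product -/

/-! Since (q^4;q^8) = (q^4;q^4)/(q^8;q^8), and since the other two products completed by (q^8;q^8)
form a theta function, F_a(q) is an elementary factor times η(8τ)² / (η(4τ) θ(aτ | 8τ)), with θ the
odd Jacobi theta function (`F_eq_eta_theta`). The theorem is then the modular transformation of η
and θ, applied with one matrix carrying dτ' to 8τ and another carrying 4τ' (d = 8) or 2dτ' (d < 8)
to 4τ (`F_modular`).

If η has multiplier ε under a matrix, θ has multiplier -iε³, so the roots of unity collapse to
-1/(εε'). The automorphy factors leave a quotient of square roots, equal to 1 for d = 8 and to 1/√2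
otherwise. Writing ah = b + dn, the new theta argument is bτ' plus n periods plus a real shift.
Quasi-periodicity removes the periods at the cost of (-1)^n and an exponential. For d = 8 the real
shift is an even integer and the quotient is again F_b; for d < 8 it produces ρ; for d = 1 also b =
0, and one factor of the theta product becomes the sine behind the cosecant. The exponents are
matched using a² = 4a - 3, which holds exactly for a = 1, 3.

The explicit multiplier (`hasMult_etaMult`) comes from the Euclidean algorithm in the modular group:
translations and inversion act on η and θ by known laws, and the formula for ε obeys the same rules,
by periodicity of the Jacobi symbol and quadratic reciprocity. The inversion law of θ is that of the
series `jacobiTheta₂`; the Jacobi triple product, a limit of the finite q-binomial theorem,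
identifies series and product. -/

/-- The finite `q`-Pochhammer symbol `(Q; Q)_n`. -/
def qFac (Q : ℂ) (n : ℕ) : ℂ := ∏ j ∈ Finset.range n, (1 - Q * Q ^ j)

lemma multipliable_qPoch (x : ℂ) {q : ℂ} (hq : ‖q‖ < 1) :
    Multipliable fun j : ℕ => 1 - x * q ^ j := by
  simp_rw [sub_eq_add_neg]
  apply multipliable_one_add_of_summable
  simp only [norm_neg, norm_mul, norm_pow]
  exact (summable_geometric_of_lt_one (norm_nonneg _) hq).mul_left _

lemma one_sub_pow_ne_zero {Q : ℂ} (hQ : ‖Q‖ < 1) (j : ℕ) : 1 - Q * Q ^ j ≠ 0 := by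
  intro h
  have h1 : Q ^ (j + 1) = 1 := by rw [pow_succ']; linear_combination -h
  have h2 : ‖Q‖ ^ (j + 1) = 1 := by rw [← norm_pow, h1, norm_one]
  exact (pow_lt_one₀ (norm_nonneg _) hQ (Nat.succ_ne_zero j)).ne h2

lemma qFac_ne_zero {Q : ℂ} (hQ : ‖Q‖ < 1) (n : ℕ) : qFac Q n ≠ 0 :=
  Finset.prod_ne_zero_iff.mpr fun j _ => one_sub_pow_ne_zero hQ j

lemma qPoch_self_ne_zero {Q : ℂ} (hQ : ‖Q‖ < 1) : qPoch Q Q ≠ 0 := by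
  unfold qPoch
  simp_rw [sub_eq_add_neg]
  refine tprod_one_add_ne_zero_of_summable (fun j => ?_) ?_
  · simpa [sub_eq_add_neg] using one_sub_pow_ne_zero hQ j
  · simp only [norm_neg, norm_mul, norm_pow]
    exact (summable_geometric_of_lt_one (norm_nonneg _) hQ).mul_left _

lemma tendsto_qFac {Q : ℂ} (hQ : ‖Q‖ < 1) : Tendsto (qFac Q) atTop (𝓝 (qPoch Q Q)) :=
  (multipliable_qPoch Q hQ).tendsto_prod_tprod_nat

/-- The finite `q`-binomial theorem, for a sequence `g` with `g (i + 1) = g i * (x * Q ^ i)`. -/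
lemma prod_one_add_eq_sum_antidiagonal {Q : ℂ} (hQ : ‖Q‖ < 1) (x : ℂ) (g : ℕ → ℂ) (h0 : g 0 = 1)
    (hg : ∀ i, g (i + 1) = g i * (x * Q ^ i)) (M : ℕ) :
    ∏ j ∈ Finset.range M, (1 + x * Q ^ j)
      = ∑ p ∈ Finset.HasAntidiagonal.antidiagonal M, qFac Q M * (qFac Q p.1)⁻¹ * (qFac Q p.2)⁻¹ * g p.1 := by
  have hs : ∀ n, qFac Q (n + 1) = qFac Q n * (1 - Q * Q ^ n) := fun n =>
    Finset.prod_range_succ _ _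
  have hinv : ∀ n, (1 - Q * Q ^ n) * (qFac Q (n + 1))⁻¹ = (qFac Q n)⁻¹ := fun n => by
    have := one_sub_pow_ne_zero hQ n
    have := qFac_ne_zero hQ n
    rw [hs]; field_simp
  induction M with
  | zero => simp [qFac, h0]
  | succ M ih =>
    have key : (1 - Q * Q ^ M) * ∑ p ∈ Finset.HasAntidiagonal.antidiagonal (M + 1),
          (qFac Q p.1)⁻¹ * (qFac Q p.2)⁻¹ * g p.1
        = (1 + x * Q ^ M) * ∑ p ∈ Finset.HasAntidiagonal.antidiagonal M,
          (qFac Q p.1)⁻¹ * (qFac Q p.2)⁻¹ * g p.1 := by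
      -- The q-Pascal rule: 1 - Q^(i+j) = (1 - Q^j) + Q^j (1 - Q^i) for i + j = M + 1. The first
      -- part kills the term j = 0 and the second the term i = 0, so both reduce to sums over the
      -- antidiagonal of M.
      have split : (1 - Q * Q ^ M) * ∑ p ∈ Finset.HasAntidiagonal.antidiagonal (M + 1),
          (qFac Q p.1)⁻¹ * (qFac Q p.2)⁻¹ * g p.1
        = ∑ p ∈ Finset.HasAntidiagonal.antidiagonal (M + 1),
            (1 - Q ^ p.2) * ((qFac Q p.1)⁻¹ * (qFac Q p.2)⁻¹ * g p.1)
          + ∑ p ∈ Finset.HasAntidiagonal.antidiagonal (M + 1),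
            Q ^ p.2 * (1 - Q ^ p.1) * ((qFac Q p.1)⁻¹ * (qFac Q p.2)⁻¹ * g p.1) := by
        rw [Finset.mul_sum, ← Finset.sum_add_distrib]
        refine Finset.sum_congr rfl fun p hp => ?_
        have : Q * Q ^ M = Q ^ p.1 * Q ^ p.2 := by
          rw [← pow_add, Finset.HasAntidiagonal.mem_antidiagonal.mp hp, pow_succ']
        rw [this]; ring
      rw [split, Finset.Nat.sum_antidiagonal_succ', Finset.Nat.sum_antidiagonal_succ]
      simp only [pow_zero, sub_self, zero_mul, mul_zero, zero_add]
      rw [add_mul, one_mul, Finset.mul_sum]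
      congr 1
      · refine Finset.sum_congr rfl fun p _ => ?_
        rw [← hinv p.2, pow_succ']; ring
      · refine Finset.sum_congr rfl fun p hp => ?_
        rw [← Finset.HasAntidiagonal.mem_antidiagonal.mp hp, ← hinv p.1, hg, pow_succ', pow_add]; ring
    have pull : ∀ n, ∑ p ∈ Finset.HasAntidiagonal.antidiagonal n,
          qFac Q n * (qFac Q p.1)⁻¹ * (qFac Q p.2)⁻¹ * g p.1
        = qFac Q n * ∑ p ∈ Finset.HasAntidiagonal.antidiagonal n,
          (qFac Q p.1)⁻¹ * (qFac Q p.2)⁻¹ * g p.1 := fun n => by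
      rw [Finset.mul_sum]
      exact Finset.sum_congr rfl fun p _ => by ring
    rw [Finset.prod_range_succ, ih, pull, pull, hs]
    linear_combination -(qFac Q M) * key

/-- `(Q; Q)_n⁻¹`, extended by zero to negative `n`. -/
def qFacInv (Q : ℂ) (n : ℤ) : ℂ := if 0 ≤ n then (qFac Q n.toNat)⁻¹ else 0

lemma exists_bound_qFacInv {Q : ℂ} (hQ : ‖Q‖ < 1) : ∃ B : ℝ, 0 ≤ B ∧ ∀ n, ‖qFacInv Q n‖ ≤ B := by
  obtain ⟨B, hB⟩ := (Metric.isBounded_range_of_tendsto _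
    ((tendsto_qFac hQ).inv₀ (qPoch_self_ne_zero hQ))).exists_norm_le
  have h0 : 0 ≤ B := (norm_nonneg _).trans (hB _ ⟨0, rfl⟩)
  refine ⟨B, h0, fun n => ?_⟩
  unfold qFacInv
  split_ifs
  · exact hB _ ⟨_, rfl⟩
  · simpa using h0

lemma exists_bound_qFac {Q : ℂ} (hQ : ‖Q‖ < 1) : ∃ B : ℝ, 0 ≤ B ∧ ∀ n, ‖qFac Q n‖ ≤ B := by
  obtain ⟨B, hB⟩ := (Metric.isBounded_range_of_tendsto _ (tendsto_qFac hQ)).exists_norm_le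
  exact ⟨B, (norm_nonneg _).trans (hB _ ⟨0, rfl⟩), fun n => hB _ ⟨n, rfl⟩⟩

lemma tendsto_qFacInv {Q : ℂ} (hQ : ‖Q‖ < 1) :
    Tendsto (qFacInv Q) atTop (𝓝 (qPoch Q Q)⁻¹) := by
  have h1 := ((tendsto_qFac hQ).inv₀ (qPoch_self_ne_zero hQ)).comp
    (tendsto_atTop_atTop.mpr fun b : ℕ => ⟨(b : ℤ), fun a ha => by omega⟩ :
      Tendsto Int.toNat atTop atTop)
  refine h1.congr' ?_
  filter_upwards [eventually_ge_atTop 0] with n hn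
  simp [qFacInv, hn]

lemma norm_exp_lt_one {τ : ℂ} (hτ : 0 < τ.im) : ‖exp (2 * Real.pi * I * τ)‖ < 1 := by
  simpa using UpperHalfPlane.norm_exp_two_pi_I_lt_one ⟨τ, hτ⟩

lemma exp_pow_eq (x : ℂ) (n : ℕ) {y : ℂ} (h : n * x = y) : exp x ^ n = exp y := by
  rw [← exp_nat_mul, h]

/-- The q-binomial theorem for 2N factors, with the first one moved down to ζQ^(-N), ζ = e^{2πiv}.
The N factors with negative exponents are inverted, and reindexing by n = i - N makes the sum
symmetric. Extending the inverse factorials by zero lets the sum run over all integers, ready for N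
→ ∞. -/
lemma finite_triple_product (v : ℂ) {τ : ℂ} (hτ : 0 < τ.im) (N : ℕ) :
    (∏ j ∈ Finset.range N,
        (1 + exp (2 * Real.pi * I * v) * exp (2 * Real.pi * I * τ) ^ j))
      * ∏ j ∈ Finset.range N,
        (1 + exp (2 * Real.pi * I * (τ - v)) * exp (2 * Real.pi * I * τ) ^ j)
      = ∑' n : ℤ, qFac (exp (2 * Real.pi * I * τ)) (2 * N)
          * qFacInv (exp (2 * Real.pi * I * τ)) (N + n)
          * qFacInv (exp (2 * Real.pi * I * τ)) (N - n) * jacobiTheta₂_term n (v - τ / 2) τ := by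
  set Q := exp (2 * Real.pi * I * τ) with hQdef
  have hQ : ‖Q‖ < 1 := norm_exp_lt_one hτ
  have hstep : ∀ n : ℤ, jacobiTheta₂_term (n + 1) (v - τ / 2) τ
      = jacobiTheta₂_term n (v - τ / 2) τ * exp (2 * Real.pi * I * (v + n * τ)) := fun n => by
    simp only [jacobiTheta₂_term, ← exp_add]; congr 1; push_cast; ring
  set t : ℤ → ℂ := fun n => jacobiTheta₂_term n (v - τ / 2) τ with ht
  have ht0 : ∀ n, t n ≠ 0 := fun n => exp_ne_zero _
  -- Consecutive theta terms have ratio e^{2πi(v + nτ)}, exactly the recurrence required of g;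
  -- dividing by the term at -N normalises g 0 = 1.
  have hfin := prod_one_add_eq_sum_antidiagonal hQ (exp (2 * Real.pi * I * (v - N * τ)))
    (fun i => t ((i : ℤ) - N) / t (-N)) (by simp [ht0]) (fun i => by
      have := hstep ((i : ℤ) - N)
      simp only [ht] at this ⊢
      rw [Nat.cast_succ, add_sub_right_comm, this, mul_div_right_comm, hQdef,
        exp_pow_eq (2 * Real.pi * I * τ) i rfl, ← exp_add]
      congr 2; push_cast; ring) (2 * N)
  -- Each factor is flipped by 1 + x = x (1 + x⁻¹), and the theta term at -M absorbs the product of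
  -- the x.
  have hneg : ∀ M : ℕ, t (-M) * ∏ j ∈ Finset.range M, (1 + exp (2 * Real.pi * I * (v - (j + 1) * τ)))
      = ∏ j ∈ Finset.range M, (1 + exp (2 * Real.pi * I * (τ - v)) * Q ^ j) := by
    intro M
    induction M with
    | zero => simp [ht, jacobiTheta₂_term]
    | succ M ih =>
      rw [Finset.prod_range_succ, Finset.prod_range_succ, ← ih]
      have h1 := hstep (-(M + 1 : ℕ))
      rw [show (-(M + 1 : ℕ) : ℤ) + 1 = -M by push_cast; ring] at h1
      have h2 : t (-M) = t (-(M + 1 : ℕ)) * exp (2 * Real.pi * I * (v - (M + 1) * τ)) := by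
        simp only [ht]; rw [h1]; congr 2; push_cast; ring
      have h3 : exp (2 * Real.pi * I * (v - (M + 1) * τ))
          * (exp (2 * Real.pi * I * (τ - v)) * Q ^ M) = 1 := by
        rw [hQdef, exp_pow_eq (2 * Real.pi * I * τ) M rfl, ← exp_add, ← exp_add]
        convert exp_zero using 2; ring
      rw [h2]
      linear_combination (-t (-(M + 1 : ℕ)) * ∏ j ∈ Finset.range M,
        (1 + exp (2 * Real.pi * I * (v - (j + 1) * τ)))) * h3
  have hprod : ∏ j ∈ Finset.range (2 * N), (1 + exp (2 * Real.pi * I * (v - N * τ)) * Q ^ j)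
      = (∏ j ∈ Finset.range N, (1 + exp (2 * Real.pi * I * (v - (j + 1) * τ))))
        * ∏ j ∈ Finset.range N, (1 + exp (2 * Real.pi * I * v) * Q ^ j) := by
    rw [two_mul, Finset.prod_range_add]
    congr 1
    · rw [← Finset.prod_range_reflect]
      refine Finset.prod_congr rfl fun j hj => ?_
      have hj' : j + 1 ≤ N := Finset.mem_range.mp hj
      rw [hQdef, exp_pow_eq (2 * Real.pi * I * τ) _ rfl, ← exp_add, Nat.sub_sub, add_comm 1 j,
        Nat.cast_sub hj']
      congr 2; push_cast; ring
    · refine Finset.prod_congr rfl fun j _ => ?_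
      rw [hQdef, exp_pow_eq (2 * Real.pi * I * τ) _ rfl, exp_pow_eq (2 * Real.pi * I * τ) _ rfl,
        ← exp_add, ← exp_add]
      congr 2; push_cast; ring
  rw [← hneg N, mul_left_comm,
    mul_comm (∏ j ∈ Finset.range N, (1 + exp (2 * Real.pi * I * v) * Q ^ j)),
    ← hprod, hfin,
    Finset.mul_sum, Finset.Nat.sum_antidiagonal_eq_sum_range_succ_mk]
  have hinj : Function.Injective fun i : ℕ => (i : ℤ) - N := fun i j h => by
    simp only at h; omega
  rw [tsum_eq_sum (s := (Finset.range (2 * N + 1)).map ⟨_, hinj⟩), Finset.sum_map]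
  · refine Finset.sum_congr rfl fun i hi => ?_
    have hi' : i ≤ 2 * N := Nat.lt_succ_iff.mp (Finset.mem_range.mp hi)
    have e1 : (N : ℤ) + (i - N) = i := by ring
    have e2 : (N : ℤ) - (i - N) = (2 * N - i : ℕ) := by omega
    simp only [Function.Embedding.coeFn_mk, e1, e2, qFacInv, Nat.cast_nonneg, if_true,
      Int.toNat_natCast]
    have cancel : ∀ u A x : ℂ, u ≠ 0 → u * (A * (x / u)) = A * x := fun u A x hu => by field_simp
    exact cancel _ _ _ (ht0 (-N))
  · intro n hn
    have : ¬ (0 ≤ (N : ℤ) + n ∧ 0 ≤ (N : ℤ) - n) := by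
      rintro ⟨h1, h2⟩
      apply hn
      simp only [Finset.mem_map, Finset.mem_range, Function.Embedding.coeFn_mk]
      exact ⟨(N + n).toNat, by omega, by omega⟩
    rw [not_and_or] at this
    rcases this with h | h
    · have h0 : qFacInv Q (N + n) = 0 := if_neg h
      simp only [h0, mul_zero, zero_mul]
    · have h0 : qFacInv Q (N - n) = 0 := if_neg h
      simp only [h0, mul_zero, zero_mul]

/-- The Jacobi triple product identity. -/
theorem jacobiTheta₂_eq_prod (v : ℂ) {τ : ℂ} (hτ : 0 < τ.im) :
    jacobiTheta₂ (v - τ / 2) τ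
      = qPoch (-exp (2 * Real.pi * I * v)) (exp (2 * Real.pi * I * τ))
        * qPoch (-exp (2 * Real.pi * I * (τ - v))) (exp (2 * Real.pi * I * τ))
        * qPoch (exp (2 * Real.pi * I * τ)) (exp (2 * Real.pi * I * τ)) := by
  set Q := exp (2 * Real.pi * I * τ) with hQdef
  have hQ : ‖Q‖ < 1 := norm_exp_lt_one hτ
  have hne := qPoch_self_ne_zero hQ
  obtain ⟨B, hB0, hB⟩ := exists_bound_qFac hQ
  obtain ⟨C, hC0, hC⟩ := exists_bound_qFacInv hQ
  have hL : Tendsto (fun N : ℕ => (∏ j ∈ Finset.range N, (1 + exp (2 * Real.pi * I * v) * Q ^ j))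
      * ∏ j ∈ Finset.range N, (1 + exp (2 * Real.pi * I * (τ - v)) * Q ^ j)) atTop
      (𝓝 (qPoch (-exp (2 * Real.pi * I * v)) Q * qPoch (-exp (2 * Real.pi * I * (τ - v))) Q)) := by
    have h1 := (multipliable_qPoch (-exp (2 * Real.pi * I * v)) hQ).tendsto_prod_tprod_nat
    have h2 := (multipliable_qPoch (-exp (2 * Real.pi * I * (τ - v))) hQ).tendsto_prod_tprod_nat
    simp only [neg_mul, sub_neg_eq_add] at h1 h2
    simpa only [qPoch, neg_mul, sub_neg_eq_add] using h1.mul h2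
  have hR : Tendsto (fun N : ℕ => ∑' n : ℤ, qFac Q (2 * N) * qFacInv Q (N + n) * qFacInv Q (N - n)
      * jacobiTheta₂_term n (v - τ / 2) τ) atTop
      (𝓝 (∑' n : ℤ, (qPoch Q Q)⁻¹ * jacobiTheta₂_term n (v - τ / 2) τ)) := by
    -- For fixed n the coefficient tends to P · P⁻¹ · P⁻¹ = P⁻¹ with P = (Q;Q)_∞. It is bounded
    -- uniformly in N and n, and the theta series converges absolutely.
    refine tendsto_tsum_of_dominated_convergence
      (bound := fun n => B * C * C * ‖jacobiTheta₂_term n (v - τ / 2) τ‖)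
      ((((summable_jacobiTheta₂_term_iff _ _).mpr hτ).norm).mul_left _) (fun n => ?_)
      (Eventually.of_forall fun N n => ?_)
    · refine Tendsto.mul_const _ ?_
      have h1 : Tendsto (fun N : ℕ => qFac Q (2 * N)) atTop (𝓝 (qPoch Q Q)) :=
        (tendsto_qFac hQ).comp (tendsto_id.const_mul_atTop' two_pos)
      have h2 : Tendsto (fun N : ℕ => qFacInv Q (N + n)) atTop (𝓝 (qPoch Q Q)⁻¹) :=
        (tendsto_qFacInv hQ).comp (tendsto_atTop_add_const_right _ _ tendsto_natCast_atTop_atTop)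
      have h3 : Tendsto (fun N : ℕ => qFacInv Q (N - n)) atTop (𝓝 (qPoch Q Q)⁻¹) :=
        (tendsto_qFacInv hQ).comp (tendsto_atTop_add_const_right _ _ tendsto_natCast_atTop_atTop)
      have := (h1.mul h2).mul h3
      rwa [mul_inv_cancel₀ hne, one_mul] at this
    · simp only [norm_mul]
      gcongr
      · exact hB _
      · exact hC _
      · exact hC _
  have := tendsto_nhds_unique (hL.congr fun N => finite_triple_product v hτ N) hR
  rw [this, tsum_mul_left, jacobiTheta₂]
  field_simp

/-! ### The eta function and the odd Jacobi theta function -/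

/-- The odd Jacobi theta function `θ₁(z | τ)`, in product form. -/
def theta (z τ : ℂ) : ℂ :=
  I * exp (Real.pi * I * τ / 4 - Real.pi * I * z)
    * (qPoch (exp (2 * Real.pi * I * z)) (exp (2 * Real.pi * I * τ))
      * qPoch (exp (2 * Real.pi * I * (τ - z))) (exp (2 * Real.pi * I * τ))
      * qPoch (exp (2 * Real.pi * I * τ)) (exp (2 * Real.pi * I * τ)))

lemma exp_eq_of_sub_eq {x y : ℂ} (n : ℤ) (h : x = y + n * (2 * Real.pi * I)) : exp x = exp y := by
  rw [h, exp_add, exp_int_mul_two_pi_mul_I, mul_one]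

lemma theta_eq_jacobiTheta₂ (z : ℂ) {τ : ℂ} (hτ : 0 < τ.im) :
    theta z τ = I * exp (Real.pi * I * τ / 4 - Real.pi * I * z)
      * jacobiTheta₂ (z + 1 / 2 - τ / 2) τ := by
  have h1 : -exp (2 * Real.pi * I * (z + 1 / 2)) = exp (2 * Real.pi * I * z) := by
    rw [mul_add, exp_add, show 2 * Real.pi * I * (1 / 2) = Real.pi * I by ring, exp_pi_mul_I]; ring
  have h2 : -exp (2 * Real.pi * I * (τ - (z + 1 / 2))) = exp (2 * Real.pi * I * (τ - z)) := by
    rw [show 2 * Real.pi * I * (τ - (z + 1 / 2)) = 2 * Real.pi * I * (τ - z) - Real.pi * I by ring,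
      exp_sub_pi_mul_I, neg_neg]
  rw [jacobiTheta₂_eq_prod _ hτ, h1, h2, theta]

lemma eta_eq (τ : ℂ) : ModularForm.eta τ = exp (Real.pi * I * τ / 12)
    * qPoch (exp (2 * Real.pi * I * τ)) (exp (2 * Real.pi * I * τ)) := by
  unfold ModularForm.eta qPoch
  congr 1
  · rw [Function.Periodic.qParam]
    congr 1; push_cast; ring
  · refine tprod_congr fun n => ?_
    rw [ModularForm.eta_q_eq_pow, pow_succ']

lemma eta_add_int (τ : ℂ) (n : ℤ) :
    ModularForm.eta (τ + n) = exp (Real.pi * I * n / 12) * ModularForm.eta τ := by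
  have h : exp (2 * Real.pi * I * (τ + n)) = exp (2 * Real.pi * I * τ) :=
    exp_eq_of_sub_eq n (by ring)
  rw [eta_eq, eta_eq, h, ← mul_assoc, ← exp_add]
  congr 2; ring

lemma theta_add_int_right (z τ : ℂ) (n : ℤ) :
    theta z (τ + n) = exp (Real.pi * I * n / 4) * theta z τ := by
  have h : exp (2 * Real.pi * I * (τ + n)) = exp (2 * Real.pi * I * τ) :=
    exp_eq_of_sub_eq n (by ring)
  have h' : exp (2 * Real.pi * I * (τ + n - z)) = exp (2 * Real.pi * I * (τ - z)) :=
    exp_eq_of_sub_eq n (by ring)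
  have h'' : exp (Real.pi * I * (τ + n) / 4 - Real.pi * I * z)
      = exp (Real.pi * I * n / 4) * exp (Real.pi * I * τ / 4 - Real.pi * I * z) := by
    rw [← exp_add]; congr 1; ring
  rw [theta, theta, h, h', h'']
  ring

lemma neg_inv_im_pos {τ : ℂ} (hτ : 0 < τ.im) : 0 < (-1 / τ).im := by
  simpa [neg_div] using UpperHalfPlane.im_inv_neg_coe_pos ⟨τ, hτ⟩

lemma ne_zero_of_im_pos {τ : ℂ} (hτ : 0 < τ.im) : τ ≠ 0 := by
  rintro rfl; simp at hτ

lemma theta_S (z : ℂ) {τ : ℂ} (hτ : 0 < τ.im) :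
    theta (z / τ) (-1 / τ)
      = -I * Complex.sqrt (-I * τ) * exp (Real.pi * I * z ^ 2 / τ) * theta z τ := by
  have hτ0 := ne_zero_of_im_pos hτ
  have hs : Complex.sqrt (-I * τ) ≠ 0 := by
    simp [Complex.sqrt, hτ0]
  rw [theta_eq_jacobiTheta₂ _ hτ, theta_eq_jacobiTheta₂ _ (neg_inv_im_pos hτ),
    jacobiTheta₂_functional_equation (z + 1 / 2 - τ / 2),
    show z / τ + 1 / 2 - -1 / τ / 2 = (z + 1 / 2 - τ / 2) / τ + 1 by field_simp; ring,
    jacobiTheta₂_add_left, show ((1 : ℂ) / 2) = 2⁻¹ by norm_num]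
  -- The functional equation carries a complex power 1/2, which is by definition the principal
  -- square root.
  change _ = -I * Complex.sqrt (-I * τ) * _ * (_ * (1 / Complex.sqrt (-I * τ) * _ * _))
  have hI : exp (Real.pi * I / 2) = I := by
    rw [show (Real.pi * I / 2 : ℂ) = Real.pi / 2 * I by ring, exp_pi_div_two_mul_I]
  have he : exp (Real.pi * I * (-1 / τ) / 4 - Real.pi * I * (z / τ)) * I
      = exp (Real.pi * I * z ^ 2 / τ) * exp (Real.pi * I * τ / 4 - Real.pi * I * z)
        * exp (-Real.pi * I * (z + 2⁻¹ - τ / 2) ^ 2 / τ) := by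
    rw [← exp_add, ← exp_add]
    have : ∀ x, exp x * I = exp (x + Real.pi * I / 2) := fun x => by rw [exp_add, hI]
    rw [this]
    congr 1
    field_simp
    ring
  have hs' : I ^ 2 * (Complex.sqrt (-I * τ) * (1 / Complex.sqrt (-I * τ))) = -1 := by
    rw [mul_one_div_cancel hs, I_sq, mul_one]
  generalize jacobiTheta₂ _ _ = J at *
  generalize exp (-Real.pi * I * (z + 2⁻¹ - τ / 2) ^ 2 / τ) = G at *
  generalize exp (Real.pi * I * τ / 4 - Real.pi * I * z) = Y at *
  generalize exp (Real.pi * I * z ^ 2 / τ) = E at *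
  linear_combination J * he + E * Y * G * J * hs'

/-! ### Principal square roots on the right half-plane -/

lemma sqrt_sq (x : ℂ) : Complex.sqrt x ^ 2 = x := by
  rw [Complex.sqrt]; exact_mod_cast cpow_nat_inv_pow x two_ne_zero

lemma sqrt_re_pos {x : ℂ} (hx : 0 < x.re) : |(Complex.sqrt x).im| < (Complex.sqrt x).re := by
  have h1 : 0 ≤ (Complex.sqrt x).re := by
    rw [Complex.sqrt, cpow_inv_two_re]; positivity
  have h2 := congrArg re (sqrt_sq x)
  rw [pow_two, mul_re] at h2
  exact abs_lt_of_sq_lt_sq (by nlinarith) h1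

lemma sqrt_eq_of_sq {w x : ℂ} (h : w ^ 2 = x) (hw : 0 < w.re) : Complex.sqrt x = w := by
  rw [Complex.sqrt, ← h]
  exact_mod_cast sq_cpow_two_inv hw

/-- The squares agree, so only a sign is in doubt. Roots of numbers in the right half-plane have
argument below π/4 in absolute value, so √A·√B has positive real part. If √I·√A·√B were -√C, then
adding real and imaginary parts would make that real part negative. -/
lemma sqrt_mul_sqrt {A B C : ℂ} (hA : 0 < A.re) (hB : 0 < B.re) (hC : 0 < C.re)
    (h : A * B = -I * C) :
    Complex.sqrt A * Complex.sqrt B = exp (-(Real.pi * I / 4)) * Complex.sqrt C := by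
  have hI : Complex.sqrt I = exp (Real.pi * I / 4) := by
    refine sqrt_eq_of_sq ?_ ?_
    · rw [← exp_nat_mul, show ((2 : ℕ) : ℂ) * (Real.pi * I / 4) = Real.pi / 2 * I by push_cast; ring,
        exp_pi_div_two_mul_I]
    · rw [exp_re]
      simp only [div_ofNat_re, div_ofNat_im, mul_I_re, mul_I_im, ofReal_re, ofReal_im]
      rw [Real.cos_pi_div_four]
      positivity
  rw [exp_neg, ← hI, eq_inv_mul_iff_mul_eq₀ (by rw [hI]; exact exp_ne_zero _)]
  have ha := abs_lt.mp (sqrt_re_pos hA)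
  have hb := abs_lt.mp (sqrt_re_pos hB)
  have hc := abs_lt.mp (sqrt_re_pos hC)
  have hsq : (Complex.sqrt I * (Complex.sqrt A * Complex.sqrt B)) ^ 2 = Complex.sqrt C ^ 2 := by
    rw [mul_pow, mul_pow, sqrt_sq, sqrt_sq, sqrt_sq, sqrt_sq, h]
    linear_combination (-C) * I_sq
  rcases sq_eq_sq_iff_eq_or_eq_neg.mp hsq with h1 | h1
  · exact h1
  · exfalso
    rw [Complex.sqrt_I] at h1
    have hr := congrArg re h1
    have hi := congrArg im h1
    simp at hr hi
    have h2 : (0 : ℝ) < √2 / 2 := by positivity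
    set a := Complex.sqrt A
    set b := Complex.sqrt B
    set c := Complex.sqrt C
    have : 0 < a.re * b.re - a.im * b.im := by nlinarith
    nlinarith [mul_pos h2 this]

lemma eta_S {τ : ℂ} (hτ : 0 < τ.im) :
    ModularForm.eta (-1 / τ) = Complex.sqrt (-I * τ) * ModularForm.eta τ := by
  have h := ModularForm.eta_comp_eq_csqrt_I_inv hτ
  simp only [Function.comp, Pi.smul_apply, Pi.mul_apply, smul_eq_mul] at h
  have hB : 0 < (-I * τ).re := by simpa using hτ
  have hb := abs_lt.mp (sqrt_re_pos hB)
  have hI : Complex.sqrt I ≠ 0 := by simp [Complex.sqrt]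
  have hs : Complex.sqrt τ = Complex.sqrt I * Complex.sqrt (-I * τ) := by
    refine sqrt_eq_of_sq ?_ ?_
    · rw [mul_pow, sqrt_sq, sqrt_sq]; linear_combination (-τ) * I_sq
    · rw [Complex.sqrt_I]
      generalize Complex.sqrt (-I * τ) = b at hb
      have h2 : (0 : ℝ) < √2 / 2 := by positivity
      simp
      nlinarith
  rw [h, hs]
  field_simp

/-! ### Multipliers of η and θ under translation and inversion -/

/-- `m` is the eta multiplier of the matrix `(a, b; c, d)` at the point `τ`, and `-i m ^ 3` is the
theta multiplier. -/
def MultAt (a b c d : ℤ) (m τ : ℂ) : Prop :=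
  ModularForm.eta ((a * τ + b) / (c * τ + d))
      = m * Complex.sqrt (-I * (c * τ + d)) * ModularForm.eta τ ∧
    ∀ z, theta (z / (c * τ + d)) ((a * τ + b) / (c * τ + d))
      = -I * m ^ 3 * Complex.sqrt (-I * (c * τ + d))
        * exp (Real.pi * I * c * z ^ 2 / (c * τ + d)) * theta z τ

/-- `m` is the eta multiplier of the matrix `(a, b; c, d)`. -/
def HasMult (a b c d : ℤ) (m : ℂ) : Prop := ∀ τ : ℂ, 0 < τ.im → MultAt a b c d m τ

lemma HasMult.shift {a b c d : ℤ} {m : ℂ} (h : HasMult a b c d m) (n : ℤ) :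
    HasMult a (a * n + b) c (c * n + d) (m * exp (Real.pi * I * n / 12)) := by
  intro τ hτ
  obtain ⟨h1, h2⟩ := h (τ + n) (by simpa using hτ)
  have e1 : (a * (τ + n) + b : ℂ) = a * τ + (a * n + b : ℤ) := by push_cast; ring
  have e2 : (c * (τ + n) + d : ℂ) = c * τ + (c * n + d : ℤ) := by push_cast; ring
  rw [e1, e2] at h1 h2
  have e3 : exp (Real.pi * I * n / 4) = exp (Real.pi * I * n / 12) ^ 3 := by
    rw [← exp_nat_mul]; congr 1; push_cast; ring
  refine ⟨?_, fun z => ?_⟩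
  · rw [h1, eta_add_int]; ring
  · rw [h2, theta_add_int_right, e3]; ring

lemma exp_neg_quarter_pow : exp (-(Real.pi * I / 4)) ^ 3 = -I * exp (-(Real.pi * I / 4)) := by
  have h : exp (-(Real.pi * I / 4)) ^ 2 = -I := by
    rw [← exp_nat_mul, show ((2 : ℕ) : ℂ) * -(Real.pi * I / 4) = -(Real.pi / 2 * I) by
      push_cast; ring, exp_neg, exp_pi_div_two_mul_I, inv_I]
  rw [pow_succ, h]

/-- The automorphy factors satisfy J(γ, -1/τ) · τ = J(γS, τ). Positivity of c and d keeps all three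
in the upper half-plane, so their roots combine by `sqrt_mul_sqrt` with the constant e^{-πi/4}. The
cube of that constant is -i times itself, so the extra -i from `theta_S` is absorbed and the shape
-i m³ persists. -/
lemma multAt_S {a b c d : ℤ} {m τ : ℂ} (hτ : 0 < τ.im) (hc : 0 < c) (hd : 0 < d) :
    MultAt a b c d m (-1 / τ) ↔ MultAt b (-a) d (-c) (m * exp (-(Real.pi * I / 4))) τ := by
  have hc' : (0 : ℝ) < c := by exact_mod_cast hc
  have hd' : (0 : ℝ) < d := by exact_mod_cast hd
  have hτ0 := ne_zero_of_im_pos hτ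
  have hJ : 0 < ((d : ℂ) * τ + ((-c : ℤ) : ℂ)).im := by
    simpa using mul_pos hd' hτ
  have hJ0 := ne_zero_of_im_pos hJ
  have e1 : (c * (-1 / τ) + d : ℂ) = (d * τ + (-c : ℤ)) / τ := by
    push_cast; field_simp; ring
  have e2 : (a * (-1 / τ) + b : ℂ) / (c * (-1 / τ) + d)
      = (b * τ + (-a : ℤ)) / (d * τ + (-c : ℤ)) := by
    rw [e1]; field_simp; push_cast; ring
  have hA : 0 < (-I * (c * (-1 / τ) + d : ℂ)).re := by
    have := mul_pos hc' (neg_inv_im_pos hτ)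
    have e : (-I * (c * (-1 / τ) + d : ℂ)).re = c * (-1 / τ).im := by
      rw [← neg_mul_eq_neg_mul, neg_re, I_mul_re, neg_neg, add_im, intCast_im, add_zero, ← ofReal_intCast,
        im_ofReal_mul]
    rwa [e]
  have hB : 0 < (-I * τ).re := by simpa using hτ
  have hC : 0 < (-I * (d * τ + ((-c : ℤ) : ℂ))).re := by simpa using mul_pos hd' hτ
  have hs := sqrt_mul_sqrt hA hB hC (by rw [e1]; field_simp)
  unfold MultAt
  refine and_congr ?_ ?_
  · rw [e2, eta_S hτ, ← mul_assoc, mul_assoc m, hs, ← mul_assoc]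
  · have key : ∀ z, -I * m ^ 3 * Complex.sqrt (-I * (c * (-1 / τ) + d))
        * exp (Real.pi * I * c * (z / τ) ^ 2 / (c * (-1 / τ) + d)) * theta (z / τ) (-1 / τ)
        = -I * (m * exp (-(Real.pi * I / 4))) ^ 3 * Complex.sqrt (-I * (d * τ + (-c : ℤ)))
        * exp (Real.pi * I * d * z ^ 2 / (d * τ + (-c : ℤ))) * theta z τ := by
      intro z
      rw [theta_S z hτ, mul_pow, exp_neg_quarter_pow]
      have he : exp (Real.pi * I * d * z ^ 2 / (d * τ + (-c : ℤ)))
          = exp (Real.pi * I * c * (z / τ) ^ 2 / (c * (-1 / τ) + d))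
            * exp (Real.pi * I * z ^ 2 / τ) := by
        rw [← exp_add, e1]; congr 1; field_simp; push_cast; ring
      rw [he]
      linear_combination (-I * m ^ 3 * exp (Real.pi * I * c * (z / τ) ^ 2 / (c * (-1 / τ) + d))
            * exp (Real.pi * I * z ^ 2 / τ) * theta z τ * (-I)) * hs
    constructor
    · intro h z
      have := h (z / τ)
      rw [key, e2, e1, div_div_div_cancel_right₀ hτ0] at this
      exact this
    · intro h z
      have := h (z * τ)
      rw [← key, ← e2, ← div_div_div_cancel_right₀ hτ0, ← e1, mul_div_cancel_right₀ _ hτ0] at this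
      exact this

lemma hasMult_S_iff {a b c d : ℤ} {m : ℂ} (hc : 0 < c) (hd : 0 < d) :
    HasMult a b c d m ↔ HasMult b (-a) d (-c) (m * exp (-(Real.pi * I / 4))) := by
  refine ⟨fun h τ hτ => (multAt_S hτ hc hd).mp (h _ (neg_inv_im_pos hτ)), fun h τ hτ => ?_⟩
  have := (multAt_S (neg_inv_im_pos hτ) hc hd).mpr (h _ (neg_inv_im_pos hτ))
  rwa [show -1 / (-1 / τ) = τ by have := ne_zero_of_im_pos hτ; field_simp] at this

/-- The matrix is T^a S T^d; S has multiplier 1 and each T contributes e^{πi/12}. -/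
lemma hasMult_base (a d : ℤ) : HasMult a (a * d - 1) 1 d (exp (Real.pi * I * (a + d) / 12)) := by
  have h0 : HasMult 0 (-1) 1 0 1 := fun τ hτ => by
    refine ⟨?_, fun z => ?_⟩
    · simpa [neg_div] using eta_S hτ
    · simpa [neg_div] using theta_S z hτ
  have h1 : HasMult a (-1) 1 0 (exp (Real.pi * I * a / 12)) := fun τ hτ => by
    obtain ⟨h1, h2⟩ := h0 τ hτ
    have hτ0 := ne_zero_of_im_pos hτ
    have e : ((a : ℂ) * τ + (-1 : ℤ)) / ((1 : ℤ) * τ + (0 : ℤ))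
        = ((0 : ℤ) * τ + (-1 : ℤ)) / ((1 : ℤ) * τ + (0 : ℤ)) + a := by
      push_cast
      simp only [one_mul, add_zero, zero_mul, zero_add]
      field_simp
      ring
    have e3 : exp (Real.pi * I * a / 4) = exp (Real.pi * I * a / 12) ^ 3 := by
      rw [← exp_nat_mul]; congr 1; push_cast; ring
    refine ⟨?_, fun z => ?_⟩
    · rw [e, eta_add_int, h1]; ring
    · rw [e, theta_add_int_right, h2, e3]; ring
  have h2 := h1.shift d
  rw [← exp_add, show Real.pi * I * a / 12 + Real.pi * I * d / 12 = Real.pi * I * (a + d) / 12 by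
    ring] at h2
  convert h2 using 1 <;> ring

/-! ### The explicit eta multiplier -/

lemma I_zpow_eq_exp (n : ℤ) : (I : ℂ) ^ n = exp (Real.pi * I * n / 2) := by
  rw [show (Real.pi * I * n / 2 : ℂ) = n * (Real.pi / 2 * I) by ring, exp_int_mul,
    exp_pi_div_two_mul_I]

lemma neg_one_zpow_eq_exp (n : ℤ) : (-1 : ℂ) ^ n = exp (Real.pi * I * n) := by
  rw [show (Real.pi * I * n : ℂ) = n * (Real.pi * I) by ring, exp_int_mul, exp_pi_mul_I]

/-- The phase `exp (π i n / 12)`. -/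
def phase (n : ℤ) : ℂ := exp (Real.pi * I / 12 * n)

lemma phase_add (m n : ℤ) : phase (m + n) = phase m * phase n := by
  rw [phase, phase, phase, ← exp_add]; congr 1; push_cast; ring

lemma phase_congr {m n : ℤ} (h : (24 : ℤ) ∣ m - n) : phase m = phase n := by
  obtain ⟨k, hk⟩ := h
  refine exp_eq_of_sub_eq k ?_
  rw [show m = n + 24 * k by omega]; push_cast; ring

lemma phase_twelve_mul (n : ℤ) : phase (12 * n) = (-1) ^ n := by
  rw [neg_one_zpow_eq_exp, phase]; congr 1; push_cast; ring

/-- Everything except the Jacobi symbol becomes one 24th root of unity, so identities between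
multipliers reduce to congruences modulo 24. -/
lemma etaMult_odd {c : ℤ} (hc : Odd c) (a b d : ℤ) :
    etaMult a b c d = (jacobiSym d c.natAbs : ℂ)
      * phase (3 * (1 - c) + (b * d * (1 - c ^ 2) + c * (a + d))) := by
  obtain ⟨k, rfl⟩ := hc
  rw [etaMult, if_pos ⟨k, rfl⟩, I_zpow_eq_exp, mul_assoc, ← exp_add, phase,
    show (1 - (2 * k + 1)) / 2 = -k by omega]
  congr 2; push_cast; ring

lemma etaMult_even {c : ℤ} (hc : ¬ Odd c) (a b d : ℤ) :
    etaMult a b c d = (jacobiSym c d.natAbs : ℂ)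
      * phase (3 * d + (a * c * (1 - d ^ 2) + d * (b - c))) := by
  rw [etaMult, if_neg hc, phase]
  congr 2; push_cast; ring

lemma dvd_mul_one_sub_sq {c : ℤ} (hc : Odd c) : (24 : ℤ) ∣ c * (1 - c ^ 2) := by
  apply Int.dvd_of_emod_eq_zero
  have h : c % 24 = 1 ∨ c % 24 = 3 ∨ c % 24 = 5 ∨ c % 24 = 7 ∨ c % 24 = 9 ∨ c % 24 = 11 ∨
      c % 24 = 13 ∨ c % 24 = 15 ∨ c % 24 = 17 ∨ c % 24 = 19 ∨ c % 24 = 21 ∨ c % 24 = 23 := by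
    obtain ⟨k, rfl⟩ := hc; omega
  rcases h with h | h | h | h | h | h | h | h | h | h | h | h <;>
    simp [pow_two, Int.mul_emod, Int.sub_emod, h]

/-- The symbol (d/c) depends only on d modulo c. By the determinant condition the phase exponents
differ by n(2b + an) · c(1 - c²), and 24 divides c(1 - c²) for odd c. -/
lemma etaMult_shift {a b c d : ℤ} (hc : Odd c) (hdet : a * d - b * c = 1) (n : ℤ) :
    etaMult a (a * n + b) c (c * n + d) = etaMult a b c d * exp (Real.pi * I * n / 12) := by
  have hp : exp (Real.pi * I * n / 12) = phase n := by rw [phase]; congr 1; ring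
  rw [etaMult_odd hc, etaMult_odd hc, hp,
    mul_assoc _ (phase _) (phase _), ← phase_add]
  congr 1
  · congr 1
    rw [jacobiSym.mod_left, jacobiSym.mod_left d]
    congr 1
    exact Int.emod_eq_emod_iff_emod_sub_eq_zero.mpr
      (Int.emod_eq_zero_of_dvd (Int.natAbs_dvd.mpr ⟨n, by ring⟩))
  · apply phase_congr
    obtain ⟨k, hk⟩ := dvd_mul_one_sub_sq hc
    refine ⟨k * (n * (2 * b + a * n)), ?_⟩
    linear_combination (n * (2 * b + a * n)) * hk + (n * (1 - c ^ 2)) * hdet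

/-- The multiplier of `γS` for `c, d > 0`. -/
lemma etaMult_S {a b c d : ℤ} (hc : 0 < c) (hd : 0 < d) (hdet : a * d - b * c = 1) :
    etaMult b (-a) d (-c) = etaMult a b c d * exp (-(Real.pi * I / 4)) := by
  have hp : exp (-(Real.pi * I / 4)) = phase (-3) := by rw [phase]; congr 1; push_cast; ring
  lift c to ℕ using hc.le
  lift d to ℕ using hd.le
  rw [hp]
  rcases Nat.even_or_odd c with hce | hco
  · have hdo : Odd (d : ℤ) := by
      by_contra h
      obtain ⟨x, rfl⟩ := hce
      obtain ⟨y, hy⟩ := Int.not_odd_iff_even.mp h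
      rw [hy] at hdet; push_cast at hdet
      have : 2 * (a * y - b * x) = 1 := by linear_combination hdet
      omega
    rw [etaMult_odd hdo, etaMult_even (c := c) (by simpa using hce),
      mul_assoc _ (phase _) (phase _), ← phase_add, Int.natAbs_natCast]
    obtain ⟨y, rfl⟩ := Int.odd_coe_nat d |>.mp hdo
    -- The sign (-1/d) = (-1)^((d-1)/2) is turned into a phase; the exponents then agree exactly,
    -- hence the witness 0.
    rw [jacobiSym.neg _ ⟨y, rfl⟩, ZMod.χ₄_eq_neg_one_pow (by omega),
      show (2 * y + 1) / 2 = y by omega, Int.cast_mul, Int.cast_pow, Int.cast_neg, Int.cast_one,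
      ← zpow_natCast, ← phase_twelve_mul, mul_comm (phase _), mul_assoc, ← phase_add]
    congr 1
    apply phase_congr
    refine ⟨0, ?_⟩
    push_cast; ring
  · rcases Nat.even_or_odd d with hde | hdo
    · rw [etaMult_odd (c := c) (by simpa using hco), etaMult_even (c := d) (by simpa using hde),
        mul_assoc _ (phase _) (phase _), ← phase_add, Int.natAbs_neg, Int.natAbs_natCast]
      congr 1
      apply phase_congr
      refine ⟨0, ?_⟩
      ring
    -- With both entries odd, reciprocity exchanges (c/d) and (d/c). Its sign and that of (-1/d)
    -- enter the phase, and the determinant condition makes the exponents equal.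
    · rw [etaMult_odd (c := c) (by simpa using hco), etaMult_odd (c := d) (by simpa using hdo),
        mul_assoc _ (phase _) (phase _), ← phase_add, Int.natAbs_natCast, Int.natAbs_natCast,
        jacobiSym.neg _ hdo, ZMod.χ₄_eq_neg_one_pow (Nat.odd_iff.mp hdo),
        jacobiSym.quadratic_reciprocity hco hdo, ← mul_assoc, ← pow_add]
      obtain ⟨x, rfl⟩ := hco
      obtain ⟨y, rfl⟩ := hdo
      rw [show (2 * y + 1) / 2 = y by omega, show (2 * x + 1) / 2 = x by omega, Int.cast_mul,
        Int.cast_pow, Int.cast_neg, Int.cast_one, ← zpow_natCast, ← phase_twelve_mul,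
        mul_comm (phase _), mul_assoc, ← phase_add]
      congr 1
      apply phase_congr
      refine ⟨0, ?_⟩
      push_cast at hdet ⊢
      linear_combination (-(2 * x + 1) * (2 * y + 1) : ℤ) * hdet

/-- Euclidean descent on c. Translation moves d within its class modulo c, and one of d % c and d %
c - c is odd because c is. Inversion then exchanges c with the absolute value of that entry, so the
lower left entry decreases and stays odd until it is 1. Staying among odd c means that
`etaMult_shift` is needed only there. -/
lemma hasMult_etaMult_of_odd (n : ℕ) : ∀ {a b c d : ℤ}, c.natAbs = n → 0 < c → Odd c →
    a * d - b * c = 1 → HasMult a b c d (etaMult a b c d) := by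
  induction n using Nat.strong_induction_on with
  | _ n ih =>
  intro a b c d hn hc hodd hdet
  -- Shifting by a multiple of the lower left entry does not affect the claim.
  have reduce : ∀ k : ℤ, HasMult a (a * k + b) c (c * k + d) (etaMult a (a * k + b) c (c * k + d)) →
      HasMult a b c d (etaMult a b c d) := by
    intro k h
    have h1 := h.shift (-k)
    rw [← etaMult_shift hodd (by linear_combination hdet)] at h1
    convert h1 using 1
    · ring
    · ring
    · congr 1 <;> ring
  rcases eq_or_lt_of_le (show 1 ≤ c from hc) with h1 | h1
  · subst h1
    obtain rfl : b = a * d - 1 := by omega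
    convert hasMult_base a d using 1
    rw [etaMult_odd odd_one, phase]
    simp
    congr 1; ring
  · have hndvd : ¬ c ∣ d := fun hcd => by
      have : c ∣ 1 := by rw [← hdet]; exact dvd_sub (hcd.mul_left a) (Dvd.intro_left b rfl)
      exact absurd (Int.le_of_dvd one_pos this) (by omega)
    have hr0 : 0 < d % c := lt_of_le_of_ne (Int.emod_nonneg _ hc.ne')
      fun h => hndvd (Int.dvd_of_emod_eq_zero h.symm)
    have hr1 : d % c < c := Int.emod_lt_of_pos _ hc
    have hdm := Int.emod_add_mul_ediv d c
    rcases Int.even_or_odd (d % c) with he | ho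
    · -- `d % c - c` is odd and negative
      refine reduce (-(d / c) - 1) ?_
      set k := -(d / c) - 1
      have hd' : c * k + d = d % c - c := by simp only [k]; linear_combination -hdm
      have ho' : Odd (-(c * k + d)) := by rw [hd']; grind
      have hdet' : -(a * k + b) * c - a * (-(c * k + d)) = 1 := by linear_combination hdet
      have h := ih (-(c * k + d)).natAbs (by omega) rfl (by omega) ho' hdet'
      have h2 := (hasMult_S_iff (by omega) hc).mp h
      rw [← etaMult_S (by omega) hc hdet', neg_neg, neg_neg] at h2
      exact h2
    · refine reduce (-(d / c)) ?_
      set k := -(d / c)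
      have hd' : c * k + d = d % c := by simp only [k]; linear_combination -hdm
      have hdet' : (a * k + b) * (-c) - (-a) * (c * k + d) = 1 := by linear_combination hdet
      have h := ih (c * k + d).natAbs (by omega) rfl (by omega) (by rwa [hd']) hdet'
      rw [hasMult_S_iff hc (by omega), ← etaMult_S hc (by omega) (by linear_combination hdet)]
      exact h

/-- The transformation law of `η` and `θ₁` under the modular group. -/
theorem hasMult_etaMult {a b c d : ℤ} (hc : 0 < c) (hdet : a * d - b * c = 1) :
    HasMult a b c d (etaMult a b c d) := by
  rcases Int.even_or_odd c with he | ho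
  · have hdo : Odd d := by
      by_contra h
      obtain ⟨x, rfl⟩ := he
      obtain ⟨y, rfl⟩ := Int.not_odd_iff_even.mp h
      have : 2 * (a * y - b * x) = 1 := by linear_combination hdet
      omega
    -- For even c the entry d is odd, and a single inversion, in the direction fixed by the sign of
    -- d, reduces to the odd case.
    rcases lt_trichotomy d 0 with hd | rfl | hd
    · have hdet' : (-b) * c - a * (-d) = 1 := by linear_combination hdet
      have h := hasMult_etaMult_of_odd _ rfl (show 0 < -d by omega) hdo.neg hdet'
      have h2 := (hasMult_S_iff (by omega) hc).mp h
      rw [← etaMult_S (by omega) hc hdet', neg_neg, neg_neg] at h2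
      exact h2
    · simp at hdo
    · rw [hasMult_S_iff hc hd, ← etaMult_S hc hd hdet]
      exact hasMult_etaMult_of_odd _ rfl hd hdo (by linear_combination hdet)
  · exact hasMult_etaMult_of_odd _ rfl hc ho hdet

/-! ### Roots of unity -/

lemma isOfFinOrder_exp_div {m : ℕ} (hm : 0 < m) (n : ℤ) :
    IsOfFinOrder (exp (Real.pi * I / m * n)) := by
  refine isOfFinOrder_iff_pow_eq_one.mpr ⟨2 * m, by omega, ?_⟩
  have hm' : (m : ℂ) ≠ 0 := by exact_mod_cast hm.ne'
  rw [← exp_nat_mul, show ((2 * m : ℕ) : ℂ) * (Real.pi * I / m * n) = n * (2 * Real.pi * I) by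
    push_cast; field_simp, exp_int_mul_two_pi_mul_I]

lemma isOfFinOrder_neg_one : IsOfFinOrder (-1 : ℂ) :=
  isOfFinOrder_iff_pow_eq_one.mpr ⟨2, by norm_num, by norm_num⟩

lemma isOfFinOrder_I : IsOfFinOrder I :=
  isOfFinOrder_iff_pow_eq_one.mpr ⟨4, by norm_num, I_pow_four⟩

lemma isOfFinOrder_inv {x : ℂ} (h : IsOfFinOrder x) : IsOfFinOrder x⁻¹ := by
  obtain ⟨n, hn, hx⟩ := isOfFinOrder_iff_pow_eq_one.mp h
  exact isOfFinOrder_iff_pow_eq_one.mpr ⟨n, hn, by rw [inv_pow, hx, inv_one]⟩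

lemma isOfFinOrder_div {x y : ℂ} (hx : IsOfFinOrder x) (hy : IsOfFinOrder y) :
    IsOfFinOrder (x / y) := by
  rw [div_eq_mul_inv]; exact (Commute.all _ _).isOfFinOrder_mul hx (isOfFinOrder_inv hy)

lemma isOfFinOrder_mul {x y : ℂ} (hx : IsOfFinOrder x) (hy : IsOfFinOrder y) :
    IsOfFinOrder (x * y) := (Commute.all _ _).isOfFinOrder_mul hx hy

lemma isOfFinOrder_neg_one_zpow (n : ℤ) : IsOfFinOrder ((-1 : ℂ) ^ n) := by
  rcases Int.even_or_odd n with h | h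
  · rw [h.neg_one_zpow]; exact IsOfFinOrder.one
  · rw [h.neg_one_zpow]; exact isOfFinOrder_neg_one

lemma isOfFinOrder_jacobiSym {m : ℤ} {n : ℕ} (h : m.gcd n = 1) :
    IsOfFinOrder (jacobiSym m n : ℂ) := by
  rcases jacobiSym.eq_one_or_neg_one h with h | h <;> rw [h]
  · simp [IsOfFinOrder.one]
  · simpa using isOfFinOrder_neg_one

/-- Determinant one makes c and d coprime, so the Jacobi symbol is ±1 rather than 0. This also
supplies the nonvanishing of the multiplier. -/
lemma isOfFinOrder_etaMult {a b c d : ℤ} (hdet : a * d - b * c = 1) :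
    IsOfFinOrder (etaMult a b c d) := by
  have hcop : IsCoprime d c := ⟨a, -b, by linear_combination hdet⟩
  have hphase : ∀ n, IsOfFinOrder (phase n) := fun n => by
    have := isOfFinOrder_exp_div (m := 12) (by norm_num) n
    exact_mod_cast this
  by_cases hc : Odd c
  · rw [etaMult_odd hc]
    refine isOfFinOrder_mul (isOfFinOrder_jacobiSym ?_) (hphase _)
    rw [Int.gcd, Int.natAbs_natCast]
    exact Int.isCoprime_iff_gcd_eq_one.mp hcop
  · rw [etaMult_even hc]
    refine isOfFinOrder_mul (isOfFinOrder_jacobiSym ?_) (hphase _)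
    rw [Int.gcd, Int.natAbs_natCast]
    exact Int.isCoprime_iff_gcd_eq_one.mp hcop.symm

lemma isOfFinOrder_ne_zero {x : ℂ} (h : IsOfFinOrder x) : x ≠ 0 := by
  rintro rfl
  obtain ⟨n, hn, hx⟩ := isOfFinOrder_iff_pow_eq_one.mp h
  simp [hn.ne'] at hx

/-! ### The transformation of `F` -/

lemma qPoch_self_eq_mul {Q : ℂ} (hQ : ‖Q‖ < 1) :
    qPoch Q Q = qPoch Q (Q ^ 2) * qPoch (Q ^ 2) (Q ^ 2) := by
  have hQ2 : ‖Q ^ 2‖ < 1 := by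
    rw [norm_pow]; exact pow_lt_one₀ (norm_nonneg _) hQ two_ne_zero
  have e1 : ∀ j : ℕ, 1 - Q * Q ^ (2 * j) = 1 - Q * (Q ^ 2) ^ j := fun j => by rw [pow_mul]
  have e2 : ∀ j : ℕ, 1 - Q * Q ^ (2 * j + 1) = 1 - Q ^ 2 * (Q ^ 2) ^ j := fun j => by
    rw [← pow_mul]; ring
  have h := tprod_even_mul_odd (f := fun j : ℕ => 1 - Q * Q ^ j)
    (by simpa only [e1] using multipliable_qPoch Q hQ2)
    (by simpa only [e2] using multipliable_qPoch (Q ^ 2) hQ2)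
  simp only [e1, e2] at h
  exact h.symm

lemma F_eq_eta_theta {a : ℕ} (ha : a ≤ 8) {τ : ℂ} (hτ : 0 < τ.im) :
    F a (exp (2 * Real.pi * I * τ))
      = I * exp (Real.pi * I * τ * (1 - a)) * (ModularForm.eta (8 * τ) ^ 2
        / (ModularForm.eta (4 * τ) * theta (a * τ) (8 * τ))) := by
  have h8 : 0 < (8 * τ).im := by simpa using hτ
  have h4 : 0 < (4 * τ).im := by simpa using hτ
  have p : ∀ (n : ℕ) (y : ℂ), n * τ = y → exp (2 * Real.pi * I * τ) ^ n = exp (2 * Real.pi * I * y) :=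
    fun n y h => exp_pow_eq _ _ (by rw [← h]; ring)
  have hsq : exp (2 * Real.pi * I * (4 * τ)) ^ 2 = exp (2 * Real.pi * I * (8 * τ)) :=
    exp_pow_eq _ _ (by push_cast; ring)
  rw [F, p a (a * τ) rfl, p 8 (8 * τ) (by norm_num), p 4 (4 * τ) (by norm_num),
    p (8 - a) (8 * τ - a * τ) (by rw [Nat.cast_sub ha]; push_cast; ring), eta_eq, eta_eq, theta,
    qPoch_self_eq_mul (norm_exp_lt_one h4), hsq]
  have hP := qPoch_self_ne_zero (norm_exp_lt_one h8)
  have he : exp (Real.pi * I * τ * (1 - a)) * exp (Real.pi * I * (8 * τ) / 12) ^ 2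
      = exp (Real.pi * I * (4 * τ) / 12)
        * exp (Real.pi * I * (8 * τ) / 4 - Real.pi * I * (a * τ)) := by
    rw [← exp_nat_mul, ← exp_add, ← exp_add]; congr 1; push_cast; ring
  generalize qPoch (exp (2 * Real.pi * I * (8 * τ))) (exp (2 * Real.pi * I * (8 * τ))) = P at *
  generalize qPoch (exp (2 * Real.pi * I * (4 * τ))) _ = O
  generalize qPoch _ _ = X
  generalize qPoch _ _ = Y
  have h1 := exp_ne_zero (Real.pi * I * (4 * τ) / 12)
  have h2 := exp_ne_zero (Real.pi * I * (8 * τ) / 4 - Real.pi * I * (a * τ))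
  generalize exp (Real.pi * I * (4 * τ) / 12) = e4 at *
  generalize exp (Real.pi * I * (8 * τ) / 4 - Real.pi * I * (a * τ)) = et at *
  -- Only the exponentials and (q^8;q^8) are cancelled, so the products in the denominator of F need
  -- not be shown nonzero.
  rw [← mul_div_assoc,
    show I * exp (Real.pi * I * τ * (1 - a)) * (exp (Real.pi * I * (8 * τ) / 12) * P) ^ 2
      = I * e4 * et * P ^ 2 * 1 by linear_combination (I * P ^ 2) * he,
    show e4 * (O * P) * (I * et * (X * Y * P)) = I * e4 * et * P ^ 2 * (X * O * Y) by ring,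
    mul_div_mul_left]
  simp [h1, h2, hP]

lemma theta_add_mul_right (z : ℂ) {τ : ℂ} (hτ : 0 < τ.im) (n : ℕ) :
    theta (z + n * τ) τ
      = (-1) ^ n * exp (-(Real.pi * I * n ^ 2 * τ + 2 * Real.pi * I * n * z)) * theta z τ := by
  have h1 : ∀ z, theta (z + τ) τ = -exp (-(Real.pi * I * τ + 2 * Real.pi * I * z)) * theta z τ := by
    intro z
    rw [theta_eq_jacobiTheta₂ _ hτ, theta_eq_jacobiTheta₂ _ hτ,
      show z + τ + 1 / 2 - τ / 2 = z + 1 / 2 - τ / 2 + τ by ring, jacobiTheta₂_add_left']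
    have he : exp (Real.pi * I * τ / 4 - Real.pi * I * (z + τ))
          * exp (-Real.pi * I * (τ + 2 * (z + 1 / 2 - τ / 2)))
        = -exp (-(Real.pi * I * τ + 2 * Real.pi * I * z))
          * exp (Real.pi * I * τ / 4 - Real.pi * I * z) := by
      rw [← exp_add, ← exp_sub_pi_mul_I, ← exp_add]; congr 1; ring
    linear_combination (I * jacobiTheta₂ (z + 1 / 2 - τ / 2) τ) * he
  induction n with
  | zero => simp
  | succ n ih =>
    rw [Nat.cast_succ, show z + (n + 1 : ℂ) * τ = z + n * τ + τ by ring, h1, ih]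
    have he : exp (-(Real.pi * I * τ + 2 * Real.pi * I * (z + n * τ)))
          * exp (-(Real.pi * I * n ^ 2 * τ + 2 * Real.pi * I * n * z))
        = exp (-(Real.pi * I * (n + 1) ^ 2 * τ + 2 * Real.pi * I * (n + 1) * z)) := by
      rw [← exp_add]; congr 1; ring
    rw [← he]; ring

lemma theta_add_even (z τ : ℂ) (n : ℤ) : theta (z + 2 * n) τ = theta z τ := by
  have e1 : exp (2 * Real.pi * I * (z + 2 * n)) = exp (2 * Real.pi * I * z) :=
    exp_eq_of_sub_eq (2 * n) (by push_cast; ring)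
  have e2 : exp (2 * Real.pi * I * (τ - (z + 2 * n))) = exp (2 * Real.pi * I * (τ - z)) :=
    exp_eq_of_sub_eq (-2 * n) (by push_cast; ring)
  have e3 : exp (Real.pi * I * τ / 4 - Real.pi * I * (z + 2 * n))
      = exp (Real.pi * I * τ / 4 - Real.pi * I * z) :=
    exp_eq_of_sub_eq (-n) (by push_cast; ring)
  rw [theta, theta, e1, e2, e3]

/-- The transformation of `F` under a pair of matrices `(α, β; c, δ)` and `(α', β'; c', δ')` that
map `σ` to `8 τ` and `σ'` to `4 τ`. -/
lemma F_modular {a : ℕ} (ha : a ≤ 8) {τ σ σ' J J' : ℂ} (hτ : 0 < τ.im) (hσ : 0 < σ.im)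
    (hσ' : 0 < σ'.im) {α β c δ α' β' c' δ' : ℤ} (hc : 0 < c) (hc' : 0 < c')
    (hdet : α * δ - β * c = 1) (hdet' : α' * δ' - β' * c' = 1)
    (hJ : c * σ + δ = J) (hJ' : c' * σ' + δ' = J')
    (h8 : 8 * τ = (α * σ + β) / J) (h4 : 4 * τ = (α' * σ' + β') / J') :
    F a (exp (2 * Real.pi * I * τ))
      = -1 / (etaMult α β c δ * etaMult α' β' c' δ')
        * (Complex.sqrt (-I * J) / Complex.sqrt (-I * J'))
        * exp (Real.pi * I * τ * (1 - a) - Real.pi * I * c * (a * τ) ^ 2 * J)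
        * (ModularForm.eta σ ^ 2 / (ModularForm.eta σ' * theta (a * τ * J) σ)) := by
  have hJ0 : J ≠ 0 := by
    refine ne_zero_of_im_pos ?_
    rw [← hJ]
    simpa using mul_pos (show (0 : ℝ) < c by exact_mod_cast hc) hσ
  obtain ⟨h1, h2⟩ := hasMult_etaMult hc hdet σ hσ
  obtain ⟨h1', -⟩ := hasMult_etaMult hc' hdet' σ' hσ'
  -- The theta law is used at aτJ, so that division by J returns the argument aτ.
  have h2 := h2 (a * τ * J)
  rw [hJ, mul_div_cancel_right₀ _ hJ0, ← h8] at h2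
  rw [hJ, ← h8] at h1
  rw [hJ', ← h4] at h1'
  have he : exp (Real.pi * I * c * (a * τ * J) ^ 2 / J)
      = exp (Real.pi * I * c * (a * τ) ^ 2 * J) := by
    congr 1; field_simp
  have hs : Complex.sqrt (-I * J) ≠ 0 := by simp [Complex.sqrt, hJ0]
  have hε := isOfFinOrder_ne_zero (isOfFinOrder_etaMult hdet)
  rw [F_eq_eta_theta ha hτ, h1, h1', h2, he, exp_sub]
  have hE := exp_ne_zero (Real.pi * I * c * (a * τ) ^ 2 * J)
  generalize exp (Real.pi * I * c * (a * τ) ^ 2 * J) = E at *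
  generalize etaMult α β c δ = ε at *
  generalize etaMult α' β' c' δ' = ε' at *
  generalize Complex.sqrt (-I * J) = s at *
  generalize Complex.sqrt (-I * J') = s' at *
  generalize ModularForm.eta σ = A at *
  generalize ModularForm.eta σ' = B at *
  generalize theta (a * τ * J) σ = T at *
  -- Multipliers: ε² from η(8τ)², ε' from η(4τ), -iε³ from θ. Together with the leading i they leave
  -- -1/(εε') and the quotient s/s'.
  have : I * (ε * s * A) ^ 2 / (ε' * s' * B * (-I * ε ^ 3 * s * E * T))
      = (-(I * ε ^ 2 * s)) * (-(s * A ^ 2)) / ((-(I * ε ^ 2 * s)) * (ε * ε' * s' * E * B * T)) := by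
    congr 1 <;> ring
  rw [mul_div_mul_left _ _ (by simp [hε, hs])] at this
  rw [mul_comm I, mul_assoc, ← mul_div_assoc, this]
  simp only [div_eq_mul_inv, mul_inv]
  ring

lemma sqrt_div_sqrt_two_mul {x : ℂ} (hx : 0 < x.re) :
    Complex.sqrt x / Complex.sqrt (2 * x) = ((1 / Real.sqrt 2 : ℝ) : ℂ) := by
  have h1 := (abs_lt.mp (sqrt_re_pos hx))
  have hpos : 0 < (Complex.sqrt x).re := by linarith
  have h2 : Complex.sqrt (2 * x) = ((Real.sqrt 2 : ℝ) : ℂ) * Complex.sqrt x := by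
    refine sqrt_eq_of_sq ?_ ?_
    · rw [mul_pow, sqrt_sq, ← ofReal_pow, Real.sq_sqrt (by norm_num)]; norm_num
    · rw [re_ofReal_mul]; positivity
  have h3 : Complex.sqrt x ≠ 0 := by
    intro h; rw [h] at hpos; simp at hpos
  rw [h2, ofReal_div, ofReal_one]
  field_simp

lemma ne_zero_of_re_pos {z : ℂ} (hz : 0 < z.re) : z ≠ 0 := by
  rintro rfl; simp at hz

lemma inv_re_pos {z : ℂ} (hz : 0 < z.re) : 0 < (z⁻¹).re := by
  rw [inv_re]; exact div_pos hz (normSq_pos.mpr (ne_zero_of_re_pos hz))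

lemma I_mul_div_im_pos {w : ℂ} (hw : 0 < w.re) {r : ℝ} (hr : 0 < r) (x : ℝ) :
    0 < (x + r * (I * w) : ℂ).im := by
  rw [add_im, ofReal_im, zero_add, im_ofReal_mul, I_mul_im]; positivity

lemma mul_exp_sub_mul_cancel (P S r X : ℂ) :
    P * exp (S - r) * I⁻¹ * (I * exp r * X) = P * exp S * X := by
  rw [exp_sub]; field_simp

/-- The transformation of `F` when `8 ∣ k`. -/
lemma F_transform_eight {a h K b n : ℕ} (ha : a ≤ 8) (hK : 0 < K) {H t : ℤ}
    (hH : h * H + 1 = 128 * K * t) (hb : a * h = b + 8 * n) (hb8 : b ≤ 8) {z : ℂ} (hz : 0 < z.re) :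
    F a (exp (2 * Real.pi * I * ((h + I * z) / (8 * K))))
      = -1 / (etaMult h (-(128 * t)) K (-H) * etaMult h (-(64 * t)) (2 * K) (-H)) * (-1) ^ n
        * exp (Real.pi * I * ((h + I * z) / (8 * K)) * (1 - a)
          + Real.pi * a ^ 2 * (h + I * z) ^ 2 / (64 * K * z)
          + (Real.pi * I * n ^ 2 * (8 * (H / (8 * K) + I * z⁻¹ / (8 * K)))
            + 2 * Real.pi * I * n * (b * (H / (8 * K) + I * z⁻¹ / (8 * K))))
          - Real.pi * I * (H / (8 * K) + I * z⁻¹ / (8 * K)) * (1 - b)) * I⁻¹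
        * F b (exp (2 * Real.pi * I * (H / (8 * K) + I * z⁻¹ / (8 * K)))) := by
  have hz0 := ne_zero_of_re_pos hz
  have hK0 : (K : ℂ) ≠ 0 := by exact_mod_cast hK.ne'
  have hK' : (0 : ℝ) < K := by exact_mod_cast hK
  have hH' : (h : ℂ) * H + 1 = 128 * K * t := by exact_mod_cast hH
  have hb' : (a : ℂ) * h = b + 8 * n := by exact_mod_cast hb
  set τ : ℂ := (h + I * z) / (8 * K) with hτdef
  set τ' : ℂ := H / (8 * K) + I * z⁻¹ / (8 * K) with hτ'def
  have hτ : 0 < τ.im := by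
    have := I_mul_div_im_pos hz (r := 1 / (8 * K)) (by positivity) (h / (8 * K))
    convert this using 2
    rw [hτdef]; push_cast; field_simp
  have hτ' : 0 < τ'.im := by
    have := I_mul_div_im_pos (inv_re_pos hz) (r := 1 / (8 * K)) (by positivity) (H / (8 * K))
    convert this using 2
    rw [hτ'def]; push_cast; field_simp
  have h8 : 0 < (8 * τ').im := by simpa using hτ'
  have h4 : 0 < (4 * τ').im := by simpa using hτ'
  -- Both automorphy factors equal i/z, so the square roots cancel.
  have key := F_modular (σ := 8 * τ') (σ' := 4 * τ') (J := I * z⁻¹) (J' := I * z⁻¹) ha hτ h8 h4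
    (α := h) (β := -(128 * t)) (c := K) (δ := -H) (α' := h) (β' := -(64 * t)) (c' := 2 * K)
    (δ' := -H) (by omega) (by omega) (by linear_combination -hH) (by linear_combination -hH)
    (by rw [hτ'def]; push_cast; field_simp; ring) (by rw [hτ'def]; push_cast; field_simp; ring)
    (by
      rw [hτ'def, hτdef]; push_cast; field_simp
      linear_combination z * I_sq - z * hH')
    (by
      rw [hτ'def, hτdef]; push_cast; field_simp
      linear_combination 4 * z * I_sq - 4 * z * hH')
  -- The real shift is -a(hH + 1)/(8K) = -16at. The congruence modulo 16k makes it an even integer;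
  -- an odd one would change the sign of θ.
  have hw : a * τ * (I * z⁻¹) = b * τ' + n * (8 * τ') + 2 * ((-(8 * a * t) : ℤ) : ℂ) := by
    rw [hτ'def, hτdef]; push_cast; field_simp
    linear_combination a * z * I_sq - a * z * hH' + (z * H + I) * hb'
  have hs : Complex.sqrt (-I * (I * z⁻¹)) ≠ 0 := by simp [Complex.sqrt, hz0]
  have hE : exp (Real.pi * I * τ * (1 - a) - Real.pi * I * (K : ℤ) * (a * τ) ^ 2 * (I * z⁻¹))
      = exp (Real.pi * I * τ * (1 - a) + Real.pi * a ^ 2 * (h + I * z) ^ 2 / (64 * K * z)) := by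
    congr 1
    rw [hτdef]; push_cast; field_simp
    linear_combination (-64 * a ^ 2 * (h + I * z) ^ 2) * I_sq
  have hn : ((-1 : ℂ) ^ n)⁻¹ = (-1) ^ n := by rw [← inv_pow, inv_neg, inv_one]
  rw [key, hw, theta_add_even, theta_add_mul_right _ h8, div_self hs, hE, F_eq_eta_theta hb8 hτ',
    mul_exp_sub_mul_cancel, exp_add _ (_ + _), exp_neg]
  simp only [div_eq_mul_inv, mul_inv, inv_inv, hn]
  ring

/-- The transformation of `F` when `k = d * K` with `d * e = 4` and `K` odd. -/
lemma F_transform_small {a h d e K b n : ℕ} (ha : a ≤ 8) (hde : d * e = 4) (hK : 0 < K) {H M : ℤ}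
    (hH : 2 * e * h * H + 1 = K * M) (hb : a * h = b + d * n) {z : ℂ} (hz : 0 < z.re) :
    F a (exp (2 * Real.pi * I * ((h + I * z) / (d * K))))
      = ((1 / Real.sqrt 2 : ℝ) : ℂ)
        * (-1 / (etaMult (2 * e * h) (-M) K (-H) * etaMult (e * h) (-M) K (-2 * H))) * (-1) ^ n
        * exp (Real.pi * I * ((h + I * z) / (d * K)) * (1 - a)
          + Real.pi * a ^ 2 * (h + I * z) ^ 2 / (8 * (d * K) * z)
          + (Real.pi * I * n ^ 2 * (d * (H / (d * K) + I * z⁻¹ / (8 * K)))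
            + 2 * Real.pi * I * n * (b * (H / (d * K) + I * z⁻¹ / (8 * K)) - a * M / 8)))
        * (qPoch (exp (2 * Real.pi * I * (d * (H / (d * K) + I * z⁻¹ / (8 * K)))))
              (exp (2 * Real.pi * I * (d * (H / (d * K) + I * z⁻¹ / (8 * K))))) ^ 2
          / (qPoch (exp (2 * Real.pi * I * (d * (H / (d * K) + I * z⁻¹ / (8 * K)))) ^ 2)
              (exp (2 * Real.pi * I * (d * (H / (d * K) + I * z⁻¹ / (8 * K)))) ^ 2)
            * theta (b * (H / (d * K) + I * z⁻¹ / (8 * K)) - a * M / 8)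
              (d * (H / (d * K) + I * z⁻¹ / (8 * K))))) := by
  have hz0 := ne_zero_of_re_pos hz
  have hd : 0 < d := Nat.pos_of_ne_zero (by rintro rfl; omega)
  have he : 0 < e := Nat.pos_of_ne_zero (by rintro rfl; omega)
  have hK0 : (K : ℂ) ≠ 0 := by exact_mod_cast hK.ne'
  have hd0 : (d : ℂ) ≠ 0 := by exact_mod_cast hd.ne'
  have hK' : (0 : ℝ) < K := by exact_mod_cast hK
  have hd' : (0 : ℝ) < d := by exact_mod_cast hd
  have hde' : (d : ℂ) * e = 4 := by exact_mod_cast hde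
  have hH' : 2 * e * (h : ℂ) * H + 1 = K * M := by exact_mod_cast hH
  have hb' : (a : ℂ) * h = b + d * n := by exact_mod_cast hb
  set τ : ℂ := (h + I * z) / (d * K) with hτdef
  set τ' : ℂ := H / (d * K) + I * z⁻¹ / (8 * K) with hτ'def
  have hτ : 0 < τ.im := by
    have := I_mul_div_im_pos hz (r := 1 / (d * K)) (by positivity) (h / (d * K))
    convert this using 2
    rw [hτdef]; push_cast; field_simp
  have hτ' : 0 < τ'.im := by
    have := I_mul_div_im_pos (inv_re_pos hz) (r := 1 / (8 * K)) (by positivity) (H / (d * K))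
    convert this using 2
    rw [hτ'def]; push_cast; field_simp
  have hσ : 0 < (d * τ').im := by
    rw [← ofReal_natCast, im_ofReal_mul]; positivity
  have h2σ : 0 < (2 * (d * τ')).im := by
    rw [← ofReal_ofNat, im_ofReal_mul]; positivity
  -- Both matrices have lower left entry K. Doubling the point and the entry -H doubles the
  -- automorphy factor, which is the source of 1/√2.
  set J : ℂ := d * (I * z⁻¹) / 8 with hJ
  have key := F_modular (σ := d * τ') (σ' := 2 * (d * τ')) (J := J) (J' := 2 * J) ha hτ hσ h2σ
    (α := 2 * e * h) (β := -M) (c := K) (δ := -H) (α' := e * h) (β' := -M) (c' := K)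
    (δ' := -2 * H) (by omega) (by omega) (by linear_combination -hH) (by linear_combination -hH)
    (by rw [hJ, hτ'def]; push_cast; field_simp; ring)
    (by rw [hJ, hτ'def]; push_cast; field_simp; ring)
    (by
      rw [hJ, hτ'def, hτdef]; push_cast; field_simp
      linear_combination 8 * z * I_sq - 8 * z * hH' - 2 * h * I * hde')
    (by
      rw [hJ, hτ'def, hτdef]; push_cast; field_simp
      linear_combination 8 * z * I_sq - 8 * z * hH' - 2 * h * I * hde')
  -- Here the real shift -aM/8 need not be an integer; it becomes ρ⁻¹ under x ↦ e^{2πix}.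
  have hw : a * τ * J = b * τ' - a * M / 8 + n * (d * τ') := by
    rw [hJ, hτ'def, hτdef]; field_simp
    linear_combination a * z * d * I_sq - a * z * d * hH' + 2 * a * z * h * H * hde'
      + (8 * z * H + I * d) * hb'
  have hs : Complex.sqrt (-I * J) / Complex.sqrt (-I * (2 * J)) = ((1 / Real.sqrt 2 : ℝ) : ℂ) := by
    rw [mul_left_comm]
    refine sqrt_div_sqrt_two_mul ?_
    have e1 : -I * J = (d / 8 : ℝ) * z⁻¹ := by
      rw [hJ]; push_cast; linear_combination (-(d / 8) * z⁻¹) * I_sq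
    rw [e1, re_ofReal_mul]
    exact mul_pos (by positivity) (inv_re_pos hz)
  have hE : exp (Real.pi * I * τ * (1 - a) - Real.pi * I * (K : ℤ) * (a * τ) ^ 2 * J)
      = exp (Real.pi * I * τ * (1 - a) + Real.pi * a ^ 2 * (h + I * z) ^ 2 / (8 * (d * K) * z)) := by
    congr 1
    rw [hJ, hτdef]; push_cast; field_simp
    linear_combination (-a ^ 2 * (h + I * z) ^ 2) * I_sq
  have hn : ((-1 : ℂ) ^ n)⁻¹ = (-1) ^ n := by rw [← inv_pow, inv_neg, inv_one]
  have hη : ∀ T : ℂ, ModularForm.eta (d * τ') ^ 2 / (ModularForm.eta (2 * (d * τ')) * T)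
      = qPoch (exp (2 * Real.pi * I * (d * τ'))) (exp (2 * Real.pi * I * (d * τ'))) ^ 2
        / (qPoch (exp (2 * Real.pi * I * (d * τ')) ^ 2) (exp (2 * Real.pi * I * (d * τ')) ^ 2)
          * T) := by
    intro T
    have e1 : exp (2 * Real.pi * I * (2 * (d * τ'))) = exp (2 * Real.pi * I * (d * τ')) ^ 2 :=
      (exp_pow_eq _ _ (by push_cast; ring)).symm
    have e2 : exp (Real.pi * I * (2 * (d * τ')) / 12) = exp (Real.pi * I * (d * τ') / 12) ^ 2 :=
      (exp_pow_eq _ _ (by push_cast; ring)).symm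
    rw [eta_eq, eta_eq, e1, e2, mul_pow, mul_assoc (exp _ ^ 2), mul_div_mul_left]
    exact pow_ne_zero _ (exp_ne_zero _)
  rw [key, hw, theta_add_mul_right _ hσ, hη, hs, hE, exp_add _ (_ + _), exp_neg]
  simp only [div_eq_mul_inv, mul_inv, inv_inv, hn]
  ring

/-! ### The four cases -/

lemma ramanujanTheta_comm (u w : ℂ) : ramanujanTheta u w = ramanujanTheta w u := by
  rw [ramanujanTheta, ramanujanTheta, mul_comm w u]; ring

lemma theta_eq_ramanujanTheta {x σ u w : ℂ} (hu : exp (2 * Real.pi * I * x) = u)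
    (hw : exp (2 * Real.pi * I * (σ - x)) = w) :
    theta x σ = I * exp (Real.pi * I * σ / 4 - Real.pi * I * x) * ramanujanTheta (-u) (-w) := by
  have h : u * w = exp (2 * Real.pi * I * σ) := by
    rw [← hu, ← hw, ← exp_add]; congr 1; ring
  rw [theta, ramanujanTheta, hu, hw, neg_mul_neg, h, neg_neg, neg_neg]

lemma neg_one_zpow_floor (x n d b : ℕ) (hd : 0 < d) (hb : b < d) (h : x = b + d * n) :
    ((-1 : ℂ) ^ ⌊(x : ℚ) / d⌋) = (-1) ^ n := by
  have : ⌊(x : ℚ) / d⌋ = n := by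
    have hd' : (0 : ℚ) < d := by exact_mod_cast hd
    rw [Int.floor_eq_iff, le_div_iff₀ hd', div_lt_iff₀ hd']
    have hb' : (b : ℚ) < d := by exact_mod_cast hb
    rw [h]; push_cast
    constructor <;> nlinarith [b.cast_nonneg (α := ℚ)]
  rw [this, zpow_natCast]

/-- The data common to the cases `d ∈ {1, 2, 4}`. -/
lemma epsD_eq {d e h K : ℕ} (hd : 0 < d) (hde : d * e = 4) (hK : 0 < K) {H M : ℤ}
    (hH : 2 * e * h * H + 1 = K * M) :
    epsD8 d h (d * K) H = etaMult (2 * e * h) (-M) K (-H) ∧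
      epsD4 d h (d * K) H = etaMult (e * h) (-M) K (-2 * H) := by
  have hd' : (d : ℤ) ≠ 0 := by exact_mod_cast hd.ne'
  have hK' : (K : ℤ) ≠ 0 := by exact_mod_cast hK.ne'
  have hde' : (d : ℤ) * e = 4 := by exact_mod_cast hde
  have e1 : (8 * h / d : ℤ) = 2 * e * h :=
    Int.ediv_eq_of_eq_mul_right hd' (by linear_combination (-2 * h) * hde')
  have e2 : (4 * h / d : ℤ) = e * h :=
    Int.ediv_eq_of_eq_mul_right hd' (by linear_combination (-h : ℤ) * hde')
  have e3 : ((d * K : ℕ) / d : ℤ) = K :=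
    Int.ediv_eq_of_eq_mul_right hd' (by push_cast; ring)
  have e4 : (d * (2 * e * h * H + 1) / (d * K : ℕ) : ℤ) = M := by
    rw [hH]
    exact Int.ediv_eq_of_eq_mul_right (by push_cast; positivity) (by push_cast; ring)
  rw [epsD8, epsD4, e1, e2, e3, e4]
  exact ⟨rfl, rfl⟩

lemma qAt_eq {h k d K : ℕ} (hk : k = d * K) (z : ℂ) :
    qAt h k z = exp (2 * Real.pi * I * ((h + I * z) / (d * K))) := by
  rw [qAt, hk]; congr 2; push_cast; ring

lemma yAt_eq {k d K : ℕ} (hd : 0 < d) (hk : k = d * K) (H : ℤ) (z : ℂ) :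
    yAt d k H z = exp (2 * Real.pi * I * (H / (d * K) + I * z⁻¹ / (8 * K))) := by
  have hd' : (d : ℂ) ≠ 0 := by exact_mod_cast hd.ne'
  rw [yAt, hk]; congr 3
  · push_cast; ring
  · push_cast; rw [mul_left_comm, mul_assoc, mul_div_mul_left _ _ hd']

lemma rho_eq {a h k d e K : ℕ} (hd : 0 < d) (hde : d * e = 4) (hK : 0 < K) (hk : k = d * K)
    {H M : ℤ} (hH : 2 * e * h * H + 1 = K * M) :
    rho a d h k H = exp (2 * Real.pi * I * (a * M / 8)) := by
  have hd' : (d : ℂ) ≠ 0 := by exact_mod_cast hd.ne'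
  have hK' : (K : ℂ) ≠ 0 := by exact_mod_cast hK.ne'
  have hde' : (d : ℂ) * e = 4 := by exact_mod_cast hde
  have hH' : 2 * e * (h : ℂ) * H + 1 = K * M := by exact_mod_cast hH
  rw [rho, hk]; congr 1
  have : (8 * h * H / d + 1 : ℂ) = K * M := by
    rw [← hH']; field_simp; linear_combination (-2 * h * H) * hde'
  rw [this]; push_cast; field_simp; ring

/-- The factor 1/i = -i from θ, times the -1 of `F_modular`, gives the leading i of ω for d = 4 and
d = 2. -/
lemma mul_exp_div_mul_cancel (P A x X Q R : ℂ) :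
    P * (A * exp x) * (X / (Q * (I * exp x * R))) = -I * (P * A * (X / (Q * R))) := by
  have h := exp_ne_zero x
  generalize exp x = E at *
  have hE : E * E⁻¹ = 1 := mul_inv_cancel₀ h
  simp only [div_eq_mul_inv, mul_inv, inv_I]
  linear_combination (-I * P * A * X * Q⁻¹ * R⁻¹) * hE

/-- The transformation formula for `gcd(k, 8) = 8`. -/
theorem F_transform_of_gcd_eight {a h k : ℕ} (ha : a = 1 ∨ a = 3) (hk0 : 0 < k)
    {z : ℂ} (hz : 0 < z.re) (hg : Nat.gcd k 8 = 8) {H : ℤ} (hH : (h : ℤ) * H ≡ -1 [ZMOD 16 * k]) :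
    (∃ n : ℕ, 0 < n ∧ omega8 a h k H ^ n = 1) ∧
      F a (qAt h k z) = omega8 a h k H
          * exp (Real.pi / (8 * k)
              * (((((a * h % 8 : ℕ) : ℂ) - 4) ^ 2 - 8) / z + z * (4 * a - 5)))
          * F (a * h % 8) (yAt 8 k H z) := by
  obtain ⟨K, rfl⟩ : 8 ∣ k := hg ▸ Nat.gcd_dvd_left k 8
  have hK : 0 < K := by omega
  obtain ⟨t, ht⟩ := hH.symm.dvd
  have ht' : h * H + 1 = 128 * K * t := by push_cast at ht; linear_combination ht
  have hKz : (K : ℤ) ≠ 0 := by exact_mod_cast hK.ne'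
  have h88 : eps88 h (8 * K) H = etaMult h (-(128 * t)) K (-H) := by
    have e1 : (8 * (h * H + 1) / (8 * K : ℕ) : ℤ) = 128 * t :=
      Int.ediv_eq_of_eq_mul_right (by push_cast; positivity)
        (by push_cast; linear_combination 8 * ht')
    have e2 : ((8 * K : ℕ) / 8 : ℤ) = K := by push_cast; omega
    rw [eps88, e1, e2]
  have h84 : eps84 h (8 * K) H = etaMult h (-(64 * t)) (2 * K) (-H) := by
    have e1 : (4 * (h * H + 1) / (8 * K : ℕ) : ℤ) = 64 * t :=
      Int.ediv_eq_of_eq_mul_right (by push_cast; positivity)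
        (by push_cast; linear_combination 4 * ht')
    have e2 : ((8 * K : ℕ) / 4 : ℤ) = 2 * K := by push_cast; omega
    rw [eps84, e1, e2]
  have hb := (Nat.mod_add_div (a * h) 8).symm
  have hb8 := Nat.mod_lt (a * h) (show 0 < 8 by norm_num)
  set b := a * h % 8 with hbdef
  set n := a * h / 8 with hndef
  have hfl := neg_one_zpow_floor (a * h) n 8 b (by norm_num) hb8 hb
  push_cast at hfl
  constructor
  · refine isOfFinOrder_iff_pow_eq_one.mp ?_
    rw [omega8, ← hbdef, h88, h84]
    refine isOfFinOrder_mul (isOfFinOrder_div (isOfFinOrder_mul isOfFinOrder_I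
      (isOfFinOrder_neg_one_zpow _)) (isOfFinOrder_mul (isOfFinOrder_etaMult (by linear_combination -ht'))
        (isOfFinOrder_etaMult (by linear_combination -ht')))) ?_
    have := isOfFinOrder_exp_div (m := 8 * (8 * K)) (by omega)
      (h * (5 - 4 * a) - H * (((b : ℤ) - 4) ^ 2 - 8))
    push_cast at this ⊢
    exact this
  · have key := F_transform_eight (by omega) hK ht' hb hb8.le hz
    rw [qAt_eq (d := 8) rfl, yAt_eq (d := 8) (by norm_num) rfl]
    push_cast
    rw [key, omega8, ← hbdef, h88, h84, hfl]
    have hz0 := ne_zero_of_re_pos hz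
    have hK0 : (K : ℂ) ≠ 0 := by exact_mod_cast hK.ne'
    have hb' : (a : ℂ) * h = b + 8 * n := by exact_mod_cast hb
    have hn : (n : ℂ) = (a * h - b) / 8 := by rw [hb']; ring
    have hexp : exp (Real.pi * I * ((h + I * z) / (8 * K)) * (1 - a)
          + Real.pi * a ^ 2 * (h + I * z) ^ 2 / (64 * K * z)
          + (Real.pi * I * n ^ 2 * (8 * (H / (8 * K) + I * z⁻¹ / (8 * K)))
            + 2 * Real.pi * I * n * (b * (H / (8 * K) + I * z⁻¹ / (8 * K))))
          - Real.pi * I * (H / (8 * K) + I * z⁻¹ / (8 * K)) * (1 - b))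
        = exp (Real.pi * I / (8 * (8 * K)) * (h * (5 - 4 * a) - H * (((b : ℂ) - 4) ^ 2 - 8)))
          * exp (Real.pi / (8 * (8 * K)) * ((((b : ℂ) - 4) ^ 2 - 8) / z + z * (4 * a - 5))) := by
      rw [← exp_add, hn]
      have ht'' : (t : ℂ) = (h * H + 1) / (128 * K) := by
        have : (h : ℂ) * H + 1 = 128 * K * t := by exact_mod_cast ht'
        rw [this]; field_simp
      -- The exponents agree only modulo 2πi: given a² = 4a - 3, their difference is πi a²h(hH +
      -- 1)/(64K) = 2πi · a²ht.
      rcases ha with rfl | rfl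
      · refine exp_eq_of_sub_eq (h * t) ?_
        push_cast
        rw [ht'']
        field_simp
        ring_nf
        simp only [I_sq]
        ring
      · refine exp_eq_of_sub_eq (9 * h * t) ?_
        push_cast
        rw [ht'']
        field_simp
        ring_nf
        simp only [I_sq]
        ring
    push_cast
    rw [hexp]
    simp only [div_eq_mul_inv, inv_I]
    ring

/-- The transformation formula for `gcd(k, 8) = 4`. -/
theorem F_transform_of_gcd_four {a h k : ℕ} (ha : a = 1 ∨ a = 3) (hk0 : 0 < k) (hcop : Nat.Coprime h k)
    {z : ℂ} (hz : 0 < z.re) (hg : Nat.gcd k 8 = 4) {H : ℤ}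
    (hH : (8 * h / 4 : ℤ) * H ≡ -1 [ZMOD k / 4]) :
    (∃ n : ℕ, 0 < n ∧ omega4 a h k H ^ n = 1) ∧
      F a (qAt h k z) = ((1 / Real.sqrt 2 : ℝ) : ℂ) * omega4 a h k H
          * exp (Real.pi / (8 * k) * (1 / z + z * (4 * a - 5)))
          * Psi4 (a * h % 4) (rho a 4 h k H) (yAt 4 k H z) := by
  obtain ⟨K, rfl⟩ : 4 ∣ k := hg ▸ Nat.gcd_dvd_left k 8
  have hK : 0 < K := by omega
  have hodd : Odd h := by
    rcases Nat.even_or_odd h with he | ho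
    · have : 2 ∣ Nat.gcd h (4 * K) := Nat.dvd_gcd he.two_dvd ⟨2 * K, by ring⟩
      rw [hcop] at this; omega
    · exact ho
  rw [show (8 * h / 4 : ℤ) = 2 * h by omega, show ((4 * K : ℕ) / 4 : ℤ) = K by push_cast; omega] at hH
  obtain ⟨M, hM⟩ := hH.symm.dvd
  have hM' : 2 * (1 : ℕ) * h * H + 1 = K * M := by push_cast; linear_combination hM
  obtain ⟨h8, h4⟩ := epsD_eq (d := 4) (by norm_num) rfl hK hM'
  have hb := (Nat.mod_add_div (a * h) 4).symm
  have hb4 := Nat.mod_lt (a * h) (show 0 < 4 by norm_num)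
  have hb13 : a * h % 4 = 1 ∨ a * h % 4 = 3 := by
    obtain ⟨j, rfl⟩ := hodd; rcases ha with rfl | rfl <;> omega
  set b := a * h % 4 with hbdef
  set n := a * h / 4 with hndef
  have hfl := neg_one_zpow_floor (a * h) n 4 b (by norm_num) hb4 hb
  push_cast at hfl
  constructor
  · refine isOfFinOrder_iff_pow_eq_one.mp ?_
    rw [omega4, ← hbdef, h8, h4]
    refine isOfFinOrder_mul (isOfFinOrder_div (isOfFinOrder_mul isOfFinOrder_I
      (isOfFinOrder_neg_one_zpow _)) (isOfFinOrder_mul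
        (isOfFinOrder_etaMult (by linear_combination -hM'))
        (isOfFinOrder_etaMult (by linear_combination -hM')))) ?_
    have := isOfFinOrder_exp_div (m := 4 * (4 * K)) (by omega)
      (h - H - h * (4 * a - 3) * (h * H + 1) + a * (2 * h * H + 1) * ((b : ℤ) - 2))
    push_cast at this ⊢
    exact this
  · have key := F_transform_small (by omega) rfl hK hM' hb hz
    have hy := yAt_eq (d := 4) (by norm_num) rfl (K := K) H z
    have hρ := rho_eq (a := a) (d := 4) (by norm_num) rfl hK rfl hM'
    rw [qAt_eq (d := 4) rfl, key, omega4, ← hbdef, h8, h4, hfl]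
    have hz0 := ne_zero_of_re_pos hz
    have hK0 : (K : ℂ) ≠ 0 := by exact_mod_cast hK.ne'
    have hb' : (a : ℂ) * h = b + 4 * n := by exact_mod_cast hb
    have hn : (n : ℂ) = (a * h - b) / 4 := by rw [hb']; ring
    have hM'' : (M : ℂ) = (2 * h * H + 1) / K := by
      have : 2 * (h : ℂ) * H + 1 = K * M := by exact_mod_cast (by simpa using hM')
      rw [this]; field_simp
    set τ' : ℂ := H / ((4 : ℕ) * K) + I * z⁻¹ / (8 * K) with hτ'
    have hY : exp (2 * Real.pi * I * ((4 : ℕ) * τ')) = yAt 4 (4 * K) H z ^ 4 := by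
      rw [hy]; exact (exp_pow_eq _ _ (by ring)).symm
    have hθ := theta_eq_ramanujanTheta (x := b * τ' - a * M / 8) (σ := (4 : ℕ) * τ')
      (u := (rho a 4 h (4 * K) H)⁻¹ * yAt 4 (4 * K) H z ^ b)
      (w := rho a 4 h (4 * K) H * yAt 4 (4 * K) H z ^ (4 - b))
      (by rw [hy, hρ, exp_pow_eq _ b rfl, ← exp_neg, ← exp_add]; congr 1; ring)
      (by rw [hy, hρ, exp_pow_eq _ (4 - b) rfl, ← exp_add, Nat.cast_sub hb4.le]; congr 1; ring)
    rw [hθ, hY, Psi4, ← pow_mul]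
    have hexp : exp (Real.pi * I * ((h + I * z) / ((4 : ℕ) * K)) * (1 - a)
          + Real.pi * a ^ 2 * (h + I * z) ^ 2 / (8 * ((4 : ℕ) * K) * z)
          + (Real.pi * I * n ^ 2 * ((4 : ℕ) * τ')
            + 2 * Real.pi * I * n * (b * τ' - a * M / 8)))
        = exp (Real.pi * I / (4 * (4 * K : ℕ)) * (h - H - h * (4 * a - 3) * (h * H + 1)
            + a * (2 * h * H + 1) * ((b : ℂ) - 2)))
          * exp (Real.pi / (8 * (4 * K : ℕ)) * (1 / z + z * (4 * a - 5)))
          * exp (Real.pi * I * ((4 : ℕ) * τ') / 4 - Real.pi * I * (b * τ' - a * M / 8)) := by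
      rw [← exp_add, ← exp_add, hn, hM'', hτ']
      -- Both a and b lie in {1, 3}. Substituting the values makes the exponents equal exactly, with
      -- no multiple of 2πi; in particular (b - 2)² = 1 gives the 1/z term.
      rcases ha with rfl | rfl <;> rcases hb13 with e | e <;> rw [e] <;>
      · congr 1
        push_cast
        field_simp
        ring_nf
        simp only [I_sq]
        ring
    rw [hexp]
    rw [mul_exp_div_mul_cancel]
    simp only [div_eq_mul_inv, mul_inv]
    ring

/-- The transformation formula for `gcd(k, 8) = 2`. -/
theorem F_transform_of_gcd_two {a h k : ℕ} (ha : a = 1 ∨ a = 3) (hk0 : 0 < k) (hcop : Nat.Coprime h k)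
    {z : ℂ} (hz : 0 < z.re) (hg : Nat.gcd k 8 = 2) {H : ℤ}
    (hH : (8 * h / 2 : ℤ) * H ≡ -1 [ZMOD k / 2]) :
    (∃ n : ℕ, 0 < n ∧ omega2 a h k H ^ n = 1) ∧
      F a (qAt h k z) = ((1 / Real.sqrt 2 : ℝ) : ℂ) * omega2 a h k H
          * exp (Real.pi / (8 * k) * (z * (4 * a - 5)))
          * Psi2 (rho a 2 h k H) (yAt 2 k H z) := by
  obtain ⟨K, rfl⟩ : 2 ∣ k := hg ▸ Nat.gcd_dvd_left k 8
  have hK : 0 < K := by omega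
  have hodd : Odd h := by
    rcases Nat.even_or_odd h with he | ho
    · have : 2 ∣ Nat.gcd h (2 * K) := Nat.dvd_gcd he.two_dvd ⟨K, rfl⟩
      rw [hcop] at this; omega
    · exact ho
  rw [show (8 * h / 2 : ℤ) = 4 * h by omega, show ((2 * K : ℕ) / 2 : ℤ) = K by push_cast; omega] at hH
  obtain ⟨M, hM⟩ := hH.symm.dvd
  have hM' : 2 * (2 : ℕ) * h * H + 1 = K * M := by push_cast; linear_combination hM
  obtain ⟨h8, h4⟩ := epsD_eq (d := 2) (by norm_num) rfl hK hM'
  have hb : a * h = 1 + 2 * (a * h / 2) := by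
    have : Odd (a * h) := Odd.mul (by rcases ha with rfl | rfl <;> decide) hodd
    have := Nat.odd_iff.mp this
    omega
  set n := a * h / 2 with hndef
  have hfl := neg_one_zpow_floor (a * h) n 2 1 (by norm_num) (by norm_num) hb
  push_cast at hfl
  constructor
  · refine isOfFinOrder_iff_pow_eq_one.mp ?_
    rw [omega2, h8, h4]
    refine isOfFinOrder_mul (isOfFinOrder_div (isOfFinOrder_mul isOfFinOrder_I
      (isOfFinOrder_neg_one_zpow _)) (isOfFinOrder_mul
        (isOfFinOrder_etaMult (by linear_combination -hM'))
        (isOfFinOrder_etaMult (by linear_combination -hM')))) ?_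
    have := isOfFinOrder_exp_div (m := 4 * (2 * K)) (by omega)
      (h * (1 - (4 * a - 3) * (2 * h * H + 1)))
    push_cast at this ⊢
    exact this
  · have key := F_transform_small (by omega) rfl hK hM' hb hz
    have hy := yAt_eq (d := 2) (by norm_num) rfl (K := K) H z
    have hρ := rho_eq (a := a) (d := 2) (by norm_num) rfl hK rfl hM'
    rw [qAt_eq (d := 2) rfl, key, omega2, h8, h4, hfl]
    have hz0 := ne_zero_of_re_pos hz
    have hK0 : (K : ℂ) ≠ 0 := by exact_mod_cast hK.ne'
    have hb' : (a : ℂ) * h = 1 + 2 * n := by exact_mod_cast hb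
    have hn : (n : ℂ) = (a * h - 1) / 2 := by rw [hb']; ring
    have hM'' : (M : ℂ) = (4 * h * H + 1) / K := by
      have : 2 * 2 * (h : ℂ) * H + 1 = K * M := by exact_mod_cast hM'
      rw [show (4 * h * H + 1 : ℂ) = K * M by rw [← this]; ring]; field_simp
    set τ' : ℂ := H / ((2 : ℕ) * K) + I * z⁻¹ / (8 * K) with hτ'
    have hY : exp (2 * Real.pi * I * ((2 : ℕ) * τ')) = yAt 2 (2 * K) H z ^ 2 := by
      rw [hy]; exact (exp_pow_eq _ _ (by ring)).symm
    have hθ := theta_eq_ramanujanTheta (x := (1 : ℕ) * τ' - a * M / 8) (σ := (2 : ℕ) * τ')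
      (u := (rho a 2 h (2 * K) H)⁻¹ * yAt 2 (2 * K) H z)
      (w := rho a 2 h (2 * K) H * yAt 2 (2 * K) H z)
      (by rw [hy, hρ, ← exp_neg, ← exp_add]; congr 1; push_cast; ring)
      (by rw [hy, hρ, ← exp_add]; congr 1; push_cast; ring)
    rw [hθ, hY, Psi2, ← pow_mul, ramanujanTheta_comm]
    have hexp : exp (Real.pi * I * ((h + I * z) / ((2 : ℕ) * K)) * (1 - a)
          + Real.pi * a ^ 2 * (h + I * z) ^ 2 / (8 * ((2 : ℕ) * K) * z)
          + (Real.pi * I * n ^ 2 * ((2 : ℕ) * τ')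
            + 2 * Real.pi * I * n * ((1 : ℕ) * τ' - a * M / 8)))
        = exp (Real.pi * I / (4 * (2 * K : ℕ)) * (h * (1 - (4 * a - 3) * (2 * h * H + 1))))
          * exp (Real.pi / (8 * (2 * K : ℕ)) * (z * (4 * a - 5)))
          * exp (Real.pi * I * ((2 : ℕ) * τ') / 4 - Real.pi * I * ((1 : ℕ) * τ' - a * M / 8)) := by
      rw [← exp_add, ← exp_add, hn, hM'', hτ']
      rcases ha with rfl | rfl <;>
      · congr 1
        push_cast
        field_simp
        ring_nf
        simp only [I_sq]
        ring
    rw [hexp, mul_exp_div_mul_cancel]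
    simp only [div_eq_mul_inv, mul_inv]
    ring

/-! ### The sine factor for odd k -/

lemma qPoch_eq_mul (x : ℂ) {q : ℂ} (hq : ‖q‖ < 1) : qPoch x q = (1 - x) * qPoch (x * q) q := by
  have h : ∀ j : ℕ, 1 - x * q * q ^ j = 1 - x * q ^ (j + 1) := fun j => by rw [pow_succ']; ring
  have hm := multipliable_qPoch (x * q) hq
  have e := tprod_eq_zero_mul' (f := fun j : ℕ => 1 - x * q ^ j) (hm.congr h)
  have e' : (1 : ℂ) - x * q ^ 0 = 1 - x := by rw [pow_zero, mul_one]
  rw [qPoch, qPoch, e, e', tprod_congr h]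

/-- The first factor 1 - e^{-2πis} of the product does not involve σ; with the prefactor i e^{πis}
it equals -2 sin πs. -/
lemma theta_neg_eq_sin (s : ℂ) {σ : ℂ} (hσ : 0 < σ.im) :
    theta (-s) σ = exp (Real.pi * I * σ / 4) * (-2 * sin (Real.pi * s))
      * (qPoch (exp (2 * Real.pi * I * s) * exp (2 * Real.pi * I * σ)) (exp (2 * Real.pi * I * σ))
        * qPoch ((exp (2 * Real.pi * I * s))⁻¹ * exp (2 * Real.pi * I * σ))
          (exp (2 * Real.pi * I * σ))
        * qPoch (exp (2 * Real.pi * I * σ)) (exp (2 * Real.pi * I * σ))) := by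
  have e1 : exp (2 * Real.pi * I * -s) = (exp (2 * Real.pi * I * s))⁻¹ := by
    rw [← exp_neg]; congr 1; ring
  have e2 : exp (2 * Real.pi * I * (σ - -s))
      = exp (2 * Real.pi * I * s) * exp (2 * Real.pi * I * σ) := by
    rw [← exp_add]; congr 1; ring
  rw [theta, e1, e2, qPoch_eq_mul _ (norm_exp_lt_one hσ)]
  have e3 : I * exp (Real.pi * I * σ / 4 - Real.pi * I * -s) * (1 - (exp (2 * Real.pi * I * s))⁻¹)
      = exp (Real.pi * I * σ / 4) * (-2 * sin (Real.pi * s)) := by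
    have e4 : exp (2 * Real.pi * I * s) = exp (Real.pi * s * I) ^ 2 :=
      (exp_pow_eq _ _ (by push_cast; ring)).symm
    have e5 : exp (Real.pi * I * σ / 4 - Real.pi * I * -s)
        = exp (Real.pi * I * σ / 4) * exp (Real.pi * s * I) := by
      rw [← exp_add]; congr 1; ring
    have e6 : exp (-(Real.pi * s) * I) = (exp (Real.pi * s * I))⁻¹ := by
      rw [← exp_neg]; congr 1; ring
    have := exp_ne_zero (Real.pi * s * I)
    rw [sin, e4, e5, e6]
    field_simp
    ring
  rw [← e3]; ring

/-- Modulo 8 the inverse M of k is k itself, so the two sines agree up to sign. The product aM is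
odd, so -aM/8 lies strictly between its floor f and f + 1, and the sign of sin(πaM/8) is (-1)^(f+1).
-/
lemma one_div_sin_eq {a k : ℕ} {M : ℤ} (ha : Odd a) (hM : Odd M) (hkM : (k : ℤ) * M ≡ 1 [ZMOD 8]) :
    1 / Real.sin (Real.pi * (a * M / 8))
      = (-1) ^ (⌊-(a * M : ℚ) / 8⌋ + 1) * |1 / Real.sin (Real.pi * a * k / 8)| := by
  have habs : |Real.sin (Real.pi * a * k / 8)| = |Real.sin (Real.pi * (a * M / 8))| := by
    have hk8 : (8 : ℤ) ∣ k - M := by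
      have hkM := (ZMod.intCast_eq_intCast_iff _ _ 8).mpr hkM
      -- Every unit modulo 8 is its own inverse.
      have key : ∀ x y : ZMod 8, x * y = 1 → y = x := by decide
      exact (ZMod.intCast_eq_intCast_iff_dvd_sub M k 8).mp (key _ _ (by exact_mod_cast hkM))
    obtain ⟨j, hj⟩ := hk8
    have hj' : (k : ℝ) = M + 8 * j := by
      have : (k : ℤ) = M + 8 * j := by linarith
      exact_mod_cast this
    rw [show Real.pi * a * k / 8 = Real.pi * (a * M / 8) + ((a * j : ℤ) : ℝ) * Real.pi by
      rw [hj']; push_cast; ring, Real.sin_add_int_mul_pi, abs_mul, abs_zpow, abs_neg, abs_one,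
      one_zpow, one_mul]
  set f := ⌊-(a * M : ℚ) / 8⌋ with hf
  have h1 : (f : ℚ) ≤ -(a * M : ℚ) / 8 := Int.floor_le _
  have h2 : -(a * M : ℚ) / 8 < f + 1 := Int.lt_floor_add_one _
  have h3 : (f : ℚ) ≠ -(a * M : ℚ) / 8 := by
    intro h
    have h' : (a : ℤ) * M = 2 * (-4 * f) := by
      have : (a : ℚ) * M = 2 * (-4 * f) := by rw [h]; ring
      exact_mod_cast this
    have : Odd ((a : ℤ) * M) := Odd.mul (by exact_mod_cast ha) hM
    rw [h'] at this
    exact (Int.not_odd_iff_even.mpr (even_two_mul _)) this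
  have h1' : (f : ℝ) < -(a * M : ℝ) / 8 := by exact_mod_cast lt_of_le_of_ne h1 h3
  have h2' : -(a * M : ℝ) / 8 < f + 1 := by exact_mod_cast h2
  have hr : 0 < Real.sin (Real.pi * (-(a * M : ℝ) / 8 - f)) := by
    apply Real.sin_pos_of_pos_of_lt_pi
    · exact mul_pos Real.pi_pos (by linarith)
    · nlinarith [Real.pi_pos]
  have hs : Real.sin (Real.pi * (a * M / 8))
      = (-1) ^ (f + 1) * Real.sin (Real.pi * (-(a * M : ℝ) / 8 - f)) := by
    rw [show Real.pi * (a * M / 8) = -(Real.pi * (-(a * M : ℝ) / 8 - f) + f * Real.pi) by ring,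
      Real.sin_neg, Real.sin_add_int_mul_pi, zpow_add_one₀ (by norm_num)]
    ring
  have habs' : |Real.sin (Real.pi * (a * M / 8))| = Real.sin (Real.pi * (-(a * M : ℝ) / 8 - f)) := by
    rw [hs, abs_mul, abs_zpow, abs_neg, abs_one, one_zpow, one_mul, abs_of_pos hr]
  rw [abs_div, abs_one, habs, habs', hs]
  have hsq : ((-1 : ℝ) ^ (f + 1)) * (-1) ^ (f + 1) = 1 := by
    rw [← mul_zpow]; norm_num
  have hne : ((-1 : ℝ) ^ (f + 1)) ≠ 0 := left_ne_zero_of_mul_eq_one hsq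
  field_simp
  rw [pow_two, hsq]

/-- The transformation formula for `k` odd. -/
theorem F_transform_of_gcd_one {a h k : ℕ} (ha : a = 1 ∨ a = 3) (hk0 : 0 < k)
    {z : ℂ} (hz : 0 < z.re) {H : ℤ}
    (hH : (8 * h : ℤ) * H ≡ -1 [ZMOD k]) :
    (∃ n : ℕ, 0 < n ∧ omega1 a h k H ^ n = 1) ∧
      F a (qAt h k z) = ((1 / (2 * Real.sqrt 2) : ℝ) : ℂ) * omega1 a h k H
          * ((|1 / Real.sin (Real.pi * a * k / 8)| : ℝ) : ℂ)
          * exp (Real.pi / (8 * k) * (1 / (4 * z) + z * (4 * a - 5)))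
          * Psi1 (rho a 1 h k H) (yAt 1 k H z) := by
  obtain ⟨M, hM⟩ := hH.symm.dvd
  have hM' : 2 * (4 : ℕ) * h * H + 1 = k * M := by push_cast; linear_combination hM
  have hao : Odd a := by rcases ha with rfl | rfl <;> decide
  have hkM : (k : ℤ) * M ≡ 1 [ZMOD 8] := by
    rw [← hM']
    exact (Int.modEq_iff_dvd.mpr ⟨-(h * H), by push_cast; ring⟩)
  have hMo : Odd M := by
    have : Odd ((k : ℤ) * M) := by rw [← hM']; exact ⟨4 * h * H, by push_cast; ring⟩
    exact (Int.odd_mul.mp this).2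
  obtain ⟨h8, h4⟩ := epsD_eq (d := 1) (by norm_num) rfl hk0 hM'
  rw [one_mul] at h8 h4
  have hkc : (k : ℂ) ≠ 0 := by exact_mod_cast hk0.ne'
  have hfl : ⌊-(a * (8 * h * H + 1) : ℚ) / (8 * k)⌋ = ⌊-(a * M : ℚ) / 8⌋ := by
    have hkq : (k : ℚ) ≠ 0 := by exact_mod_cast hk0.ne'
    have : (8 * h * H + 1 : ℚ) = k * M := by
      have : (8 * h * H + 1 : ℤ) = k * M := by push_cast at hM'; linear_combination hM'
      exact_mod_cast this
    rw [this]; congr 1; field_simp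
  constructor
  · refine isOfFinOrder_iff_pow_eq_one.mp ?_
    rw [omega1, h8, h4]
    refine isOfFinOrder_mul (isOfFinOrder_div (isOfFinOrder_neg_one_zpow _) (isOfFinOrder_mul
        (isOfFinOrder_etaMult (by linear_combination -hM'))
        (isOfFinOrder_etaMult (by linear_combination -hM')))) ?_
    have := isOfFinOrder_exp_div (m := 4 * k) (by omega)
      (4 * h * (1 - a + h * H * (3 - 4 * a)) - H)
    push_cast at this ⊢
    exact this
  -- For d = 1 the residue b is 0 and n = ah, so the theta argument is the real number -aM/8.
  · have key := F_transform_small (a := a) (b := 0) (n := a * h) (by omega) (show 1 * 4 = 4 from rfl)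
      hk0 hM' (by ring) hz
    have hy := yAt_eq (d := 1) (K := k) (by norm_num) (one_mul k).symm H z
    have hρ := rho_eq (a := a) (d := 1) (by norm_num) rfl hk0 (one_mul k).symm hM'
    have hq := qAt_eq (h := h) (d := 1) (one_mul k).symm z
    have hz0 := ne_zero_of_re_pos hz
    have hM'' : (M : ℂ) = (8 * h * H + 1) / k := by
      have : 2 * 4 * (h : ℂ) * H + 1 = k * M := by exact_mod_cast hM'
      rw [show (8 * h * H + 1 : ℂ) = k * M by rw [← this]; ring]; field_simp
    simp only [Nat.cast_one, one_mul, Nat.cast_zero, zero_mul, zero_sub] at key hy hq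
    set τ' : ℂ := H / k + I * z⁻¹ / (8 * k) with hτ'
    have hτ'_im : 0 < τ'.im := by
      have := I_mul_div_im_pos (inv_re_pos hz) (r := 1 / (8 * k))
        (by have : (0 : ℝ) < k := by exact_mod_cast hk0
            positivity) (H / k)
      convert this using 2
      rw [hτ']; push_cast; field_simp
    have hexp : exp (Real.pi * I * ((h + I * z) / k) * (1 - a)
          + Real.pi * a ^ 2 * (h + I * z) ^ 2 / (8 * k * z)
          + (Real.pi * I * (a * h : ℕ) ^ 2 * τ'
            + 2 * Real.pi * I * (a * h : ℕ) * (-(a * M / 8))))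
        = exp (Real.pi * I / (4 * k) * (4 * h * (1 - a + h * H * (3 - 4 * a)) - H))
          * exp (Real.pi / (8 * k) * (1 / (4 * z) + z * (4 * a - 5)))
          * exp (Real.pi * I * τ' / 4) := by
      rw [← exp_add, ← exp_add, hM'', hτ']
      rcases ha with rfl | rfl <;>
      · congr 1
        push_cast
        field_simp
        ring_nf
        simp only [I_sq]
        ring
    have hsin : (sin (Real.pi * (a * M / 8)))⁻¹ = (-1) ^ (⌊-(a * M : ℚ) / 8⌋ + 1)
        * ((|1 / Real.sin (Real.pi * a * k / 8)| : ℝ) : ℂ) := by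
      have := congrArg ((↑) : ℝ → ℂ) (one_div_sin_eq hao hMo hkM)
      rw [one_div] at this
      push_cast at this ⊢
      exact this
    -- As a is odd, (-1)^(ah) = (-1)^h; the exponents f + 1 + h and f + h - 1 differ by 2.
    have hsgn : (-1 : ℂ) ^ (a * h) * (-1) ^ (⌊-(a * M : ℚ) / 8⌋ + 1)
        = (-1) ^ (⌊-(a * M : ℚ) / 8⌋ + h - 1) := by
      rw [pow_mul, hao.neg_one_pow, ← zpow_natCast, ← zpow_add₀ (by norm_num),
        show (h : ℤ) + (⌊-(a * M : ℚ) / 8⌋ + 1) = (⌊-(a * M : ℚ) / 8⌋ + h - 1) + 2 by ring,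
        zpow_add₀ (by norm_num)]
      norm_num
    have hP := qPoch_self_ne_zero (norm_exp_lt_one hτ'_im)
    rw [hq, key, hexp, theta_neg_eq_sin _ hτ'_im, omega1, h8, h4, hfl, ← hsgn, Psi1, ← hρ, ← hy]
    rw [← hy] at hP
    have h0 := exp_ne_zero (Real.pi * I * τ' / 4)
    generalize exp (Real.pi * I * τ' / 4) = E at *
    generalize qPoch (yAt 1 k H z) (yAt 1 k H z) = P at *
    have hE : E * E⁻¹ = 1 := mul_inv_cancel₀ h0
    have hP' : P ^ 2 * P⁻¹ = P := by field_simp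
    have hc : ((1 / (2 * Real.sqrt 2) : ℝ) : ℂ) = ((1 / Real.sqrt 2 : ℝ) : ℂ) * 2⁻¹ := by
      push_cast; rw [one_div, one_div, mul_inv, mul_comm]
    rw [hc]
    generalize ((|1 / Real.sin (Real.pi * a * k / 8)| : ℝ) : ℂ) = W at *
    generalize sin (Real.pi * (a * M / 8)) = S at *
    generalize ((1 / Real.sqrt 2 : ℝ) : ℂ) = c
    generalize (-1 : ℂ) ^ (⌊-(a * M : ℚ) / 8⌋ + 1) = G at *
    generalize (-1 : ℂ) ^ (a * h) = N at *
    generalize exp _ = A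
    generalize exp _ = B
    generalize etaMult _ _ _ (-H) = ε
    generalize etaMult _ _ _ (-2 * H) = ε'
    generalize qPoch (_ ^ 2) _ = Q
    generalize qPoch (rho a 1 h k H * _) _ = X
    generalize qPoch ((rho a 1 h k H)⁻¹ * _) _ = Y
    have hEP : E * E⁻¹ * (P ^ 2 * P⁻¹) = P := by rw [hE, hP', one_mul]
    simp only [div_eq_mul_inv, mul_inv, hsin]
    linear_combination (c * 2⁻¹ * N * G * W * A * B * ε⁻¹ * ε'⁻¹ * Q⁻¹ * X⁻¹ * Y⁻¹) * hEP

end GollnitzGordon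

end

theorem mainTheorem2 (a : ℕ) (ha : a = 1 ∨ a = 3) (h k : ℕ) (hhk : h < k)
    (hcop : Nat.Coprime h k) (z : ℂ) (hz : 0 < z.re) :
    (Nat.gcd k 8 = 8 → ∀ H : ℤ, (h : ℤ) * H ≡ -1 [ZMOD 16 * k] →
      (∃ n : ℕ, 0 < n ∧ GollnitzGordon.omega8 a h k H ^ n = 1) ∧
      GollnitzGordon.F a (GollnitzGordon.qAt h k z) =
        GollnitzGordon.omega8 a h k H
          * Complex.exp (Real.pi / (8 * k)
              * (((((a * h % 8 : ℕ) : ℂ) - 4) ^ 2 - 8) / z + z * (4 * a - 5)))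
          * GollnitzGordon.F (a * h % 8) (GollnitzGordon.yAt 8 k H z)) ∧
    (Nat.gcd k 8 = 4 → ∀ H : ℤ, (8 * h / 4 : ℤ) * H ≡ -1 [ZMOD k / 4] →
      (∃ n : ℕ, 0 < n ∧ GollnitzGordon.omega4 a h k H ^ n = 1) ∧
      GollnitzGordon.F a (GollnitzGordon.qAt h k z) =
        ((1 / Real.sqrt 2 : ℝ) : ℂ) * GollnitzGordon.omega4 a h k H
          * Complex.exp (Real.pi / (8 * k) * (1 / z + z * (4 * a - 5)))
          * GollnitzGordon.Psi4 (a * h % 4) (GollnitzGordon.rho a 4 h k H)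
              (GollnitzGordon.yAt 4 k H z)) ∧
    (Nat.gcd k 8 = 2 → ∀ H : ℤ, (8 * h / 2 : ℤ) * H ≡ -1 [ZMOD k / 2] →
      (∃ n : ℕ, 0 < n ∧ GollnitzGordon.omega2 a h k H ^ n = 1) ∧
      GollnitzGordon.F a (GollnitzGordon.qAt h k z) =
        ((1 / Real.sqrt 2 : ℝ) : ℂ) * GollnitzGordon.omega2 a h k H
          * Complex.exp (Real.pi / (8 * k) * (z * (4 * a - 5)))
          * GollnitzGordon.Psi2 (GollnitzGordon.rho a 2 h k H)
              (GollnitzGordon.yAt 2 k H z)) ∧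
    (Nat.gcd k 8 = 1 → ∀ H : ℤ, (8 * h : ℤ) * H ≡ -1 [ZMOD k] →
      (∃ n : ℕ, 0 < n ∧ GollnitzGordon.omega1 a h k H ^ n = 1) ∧
      GollnitzGordon.F a (GollnitzGordon.qAt h k z) =
        ((1 / (2 * Real.sqrt 2) : ℝ) : ℂ) * GollnitzGordon.omega1 a h k H
          * ((|1 / Real.sin (Real.pi * a * k / 8)| : ℝ) : ℂ)
          * Complex.exp (Real.pi / (8 * k) * (1 / (4 * z) + z * (4 * a - 5)))
          * GollnitzGordon.Psi1 (GollnitzGordon.rho a 1 h k H)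
              (GollnitzGordon.yAt 1 k H z)) := by
  have hk : 0 < k := by omega
  exact ⟨fun hg _ hH => GollnitzGordon.F_transform_of_gcd_eight ha hk hz hg hH,
    fun hg _ hH => GollnitzGordon.F_transform_of_gcd_four ha hk hcop hz hg hH,
    fun hg _ hH => GollnitzGordon.F_transform_of_gcd_two ha hk hcop hz hg hH,
    fun _ _ hH => GollnitzGordon.F_transform_of_gcd_one ha hk hz hH⟩
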